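/- Let $m_1,m_2$ be natural numbers, $m=m_1+m_2$, and let $v$ be an $m_1\times m_2$ complex matrix function on $[0,\infty)$ that is measurable and summable on every finite interval. Put $$j=\begin{bmatrix} I_{m_1}&0\\0&-I_{m_2}\end{bmatrix},\qquad V=\begin{bmatrix}0&v\\v^*&0\end{bmatrix}.$$ Then for each $z\in\mathbb C$ the Dirac system $\frac{d}{dx}u(x,z)=\mathrm i\,(zj+jV(x))\,u(x,z)$ ($x\ge 0$) has exactly one locally absolutely continuous $m\times m$ solution $u$ (satisfying the equation for almost every $x$) with $u(0,z)=I_m$, and $u(x,z)$ is invertible for all $x\ge 0$. A nonsingular matrix function with property-$j$ is an $m\times m_1$ matrix function $\mathcal P$, meromorphic in the open upper half-plane $\mathbb C_+$, such that $$\mathcal P(z)^*\mathcal P(z)>0,\qquad \mathcal P(z)^*j\,\mathcal P(z)\ge 0 \tag{1}$$ for all $z\in\mathbb C_+$ outside a discrete set. For $x\ge 0$, $z\in\mathbb C_+$ let $\mathcal N(x,z)$ be the set of the values at $x,z$ of the functions $$\varphi(x,z,\mathcal P)=\begin{bmatrix}0&I_{m_2}\end{bmatrix}u(x,z)^{-1}\mathcal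 P(z)\Big(\begin{bmatrix}I_{m_1}&0\end{bmatrix}u(x,z)^{-1}\mathcal P(z)\Big)^{-1},$$ where $\mathcal P$ runs over all nonsingular matrix functions with property-$j$, and where the value of the meromorphic function $\varphi(x,\cdot,\mathcal P)$ at a point $z$ is its limit along punctured neighbourhoods of $z$. (i) The sets $\mathcal N(x,z)$ are well defined: for every $x\ge0$ and every such $\mathcal P$, $\det\big([I_{m_1}\ \,0]\,u(x,z)^{-1}\mathcal P(z)\big)\ne 0$ at each $z\in\mathbb C_+$ where (1) holds. Moreover, there is a matrix function $g$, analytic in $\mathbb C_+$, such that for every $z\in\mathbb C_+$ we have $\varphi(x,\zeta,\mathcal P)\to g(z)$ as $\zeta\to z$, $\zeta\neq z$, and $g(z)$ is given by the displayed formula at each $z$ where $\mathcal P$ is continuous and (1) holds. (ii) For $x\ge 0$ and $z\in\mathbb C_+$ the set $\mathcal N(x,z)$ is a matrix ball, that is, $\mathcal N(x,z)=\{c+\rho_l\,\omega\,\rho_r:\ \omega\in\mathbb C^{m_2\times m_1},\ \omega^*\omega\le I_{m_1}\}$ for some $m_2\times m_1$ matrix $c$ and some positive definite matrices $\rho_l$,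 $\rho_r$ (of sizes $m_2\times m_2$ and $m_1\times m_1$, depending on $x,z$). These balls are nested: $\mathcal N(x_1,z)\subseteq\mathcal N(x_2,z)$ for $0\le x_2\le x_1$. (iii) There is a unique $m_2\times m_1$ matrix function $\varphi$ on $\mathbb C_+$ such that $\bigcap_{0\le x<\infty}\mathcal N(x,z)=\{\varphi(z)\}$ for every $z\in\mathbb C_+$. This function is analytic in $\mathbb C_+$ and non-expansive: $\varphi(z)^*\varphi(z)\le I_{m_1}$ for all $z\in\mathbb C_+$. -/

import Mathlib

open Set Filter Topology MeasureTheory Matrix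
open scoped ComplexOrder

namespace DiracWeyl

/-- The open upper half-plane, as a subset of `ℂ`. -/
def upperPlane : Set ℂ := {z | 0 < z.im}

/-- The signature matrix `j = diag(I_{m₁}, -I_{m₂})`. -/
def sig (m₁ m₂ : ℕ) : Matrix (Fin m₁ ⊕ Fin m₂) (Fin m₁ ⊕ Fin m₂) ℂ :=
  fromBlocks 1 0 0 (-1)

/-- The matrix `V = [[0, v], [v*, 0]]`. -/
def bigV {m₁ m₂ : ℕ} (v : Matrix (Fin m₁) (Fin m₂) ℂ) :
    Matrix (Fin m₁ ⊕ Fin m₂) (Fin m₁ ⊕ Fin m₂) ℂ :=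
  fromBlocks 0 v vᴴ 0

/-- The potential is measurable and summable on all finite intervals of `[0, ∞)`. -/
def LocallySummable {m₁ m₂ : ℕ} (v : ℝ → Matrix (Fin m₁) (Fin m₂) ℂ) : Prop :=
  ∀ i k, LocallyIntegrableOn (fun x => v x i k) (Ici 0) volume

/-- `u` is the fundamental solution on `[0, ∞)`, at the spectral parameter `z`, of
`y' = i (z j + j V(x)) y`, normalized by `u(0) = I`: it is locally absolutely continuous and the
equation holds almost everywhere. -/
structure IsFundamentalSolution {m₁ m₂ : ℕ} (v : ℝ → Matrix (Fin m₁) (Fin m₂) ℂ) (z : ℂ)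
    (u : ℝ → Matrix (Fin m₁ ⊕ Fin m₂) (Fin m₁ ⊕ Fin m₂) ℂ) : Prop where
  absolutelyContinuous :
    ∀ l : ℝ, 0 ≤ l → ∀ a b, AbsolutelyContinuousOnInterval (fun x => u x a b) 0 l
  initial : u 0 = 1
  equation : ∀ᵐ x ∂(volume.restrict (Ioi (0 : ℝ))), ∀ a b,
    HasDerivAt (fun t => u t a b)
      ((Complex.I • ((z • sig m₁ m₂ + sig m₁ m₂ * bigV (v x)) * u x)) a b) x

/-- The fundamental solution `u(x, z)`. That it exists and is unique on `[0, ∞)` is part of the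
theorem. -/
noncomputable def fundSol {m₁ m₂ : ℕ} (v : ℝ → Matrix (Fin m₁) (Fin m₂) ℂ) (x : ℝ) (z : ℂ) :
    Matrix (Fin m₁ ⊕ Fin m₂) (Fin m₁ ⊕ Fin m₂) ℂ :=
  Classical.epsilon (fun u => IsFundamentalSolution v z u) x

/-- The two inequalities `Q* Q > 0`, `Q* j Q ≥ 0` for an `m × m₁` matrix `Q`. -/
def NonsingularJ {m₁ m₂ : ℕ} (Q : Matrix (Fin m₁ ⊕ Fin m₂) (Fin m₁) ℂ) : Prop :=
  (Qᴴ * Q).PosDef ∧ (Qᴴ * sig m₁ m₂ * Q).PosSemidef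

/-- Nonsingular matrix functions with property-`j`: meromorphic in the open upper half-plane, with
`P* P > 0` and `P* j P ≥ 0` there outside a discrete set of points. -/
def IsParameter {m₁ m₂ : ℕ} (P : ℂ → Matrix (Fin m₁ ⊕ Fin m₂) (Fin m₁) ℂ) : Prop :=
  (∀ a k, MeromorphicOn (fun z => P z a k) upperPlane) ∧
    ∀ᶠ z in codiscreteWithin upperPlane, NonsingularJ (P z)

/-- The Möbius (linear fractional) expression
`φ(x, z, P) = ([0 I] u(x,z)⁻¹ P(z)) ([I 0] u(x,z)⁻¹ P(z))⁻¹`. -/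
noncomputable def mobius {m₁ m₂ : ℕ} (v : ℝ → Matrix (Fin m₁) (Fin m₂) ℂ) (x : ℝ)
    (P : ℂ → Matrix (Fin m₁ ⊕ Fin m₂) (Fin m₁) ℂ) (z : ℂ) : Matrix (Fin m₂) (Fin m₁) ℂ :=
  ((fundSol v x z)⁻¹ * P z).toRows₂ * (((fundSol v x z)⁻¹ * P z).toRows₁)⁻¹

/-- The set `𝒩(x, z)` of the values at `x, z` of the functions `φ(x, ·, P)`, where `P` runs over
all parameter functions. The value at `z` of the meromorphic function `φ(x, ·, P)` is its limit
along the punctured neighbourhoods of `z`, so that exceptional points of `P` (poles, points of rank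
deficiency) are treated as removable singularities. -/
def N {m₁ m₂ : ℕ} (v : ℝ → Matrix (Fin m₁) (Fin m₂) ℂ) (x : ℝ) (z : ℂ) :
    Set (Matrix (Fin m₂) (Fin m₁) ℂ) :=
  {W | ∃ P : ℂ → Matrix (Fin m₁ ⊕ Fin m₂) (Fin m₁) ℂ,
    IsParameter P ∧ Tendsto (mobius v x P) (𝓝[≠] z) (𝓝 W)}

/-- Non-expansive matrices: `α* α ≤ I`. -/
def NonExpansive {p q : ℕ} (α : Matrix (Fin p) (Fin q) ℂ) : Prop :=
  (1 - αᴴ * α).PosSemidef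

/-- Matrix balls: sets `{c + ρₗ ω ρᵣ : ω* ω ≤ I}` with positive definite semi-radii. -/
def IsMatrixBall {p q : ℕ} (S : Set (Matrix (Fin p) (Fin q) ℂ)) : Prop :=
  ∃ (c : Matrix (Fin p) (Fin q) ℂ) (ρl : Matrix (Fin p) (Fin p) ℂ)
    (ρr : Matrix (Fin q) (Fin q) ℂ), ρl.PosDef ∧ ρr.PosDef ∧
    S = {W | ∃ ω : Matrix (Fin p) (Fin q) ℂ, NonExpansive ω ∧ W = c + ρl * ω * ρr}

/-- Entrywise analyticity of a matrix function in the open upper half-plane. -/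
def AnalyticInUpperPlane {p q : ℕ} (g : ℂ → Matrix (Fin p) (Fin q) ℂ) : Prop :=
  ∀ i k, AnalyticOnNhd ℂ (fun z => g z i k) upperPlane

end DiracWeyl

namespace DiracWeyl

/-! ### Linear Volterra equations with summable coefficients -/

section Volterra

open scoped BoundedContinuousFunction

variable {a : ℝ → ℝ}

/-! The engine is the Lagrange identity `(y* j w)' = i (z - conj z') y* w` for solutions `w`, `y` at
parameters `z`, `z'`. For `z' = conj z` the form is constant, so `j u(x, conj z)* j` inverts `u(x,
z)`; this yields both invertibility and uniqueness. For `z' = z` it shows that `S(x) = u* j u`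
decreases from `S(0) = j` at the rate `2 Im z u* u`.

Substituting `P = u [I; W]` identifies `N v x z` with the disc of all `W` satisfying `[I W*] S(x)
[I; W] ≥ 0` (`N_eq_matrixDisc`). Monotonicity of `S` makes the discs nested and contained in the
unit ball, and completing the square shows that each is a matrix ball. The estimate `-S₂₂ ≥ (1 + 2 x
Im z) I` and the parallelogram identity bound the squared entrywise diameter by `4 / (1 + 2 x Im
z)`. By compactness the discs have a common point, which this bound makes unique. The bound is
uniform for `Im z` bounded below, so the limit point is a locally uniform limit of analytic
functions.

Existence of `u`, and its holomorphy in `z`, come from inverting `1 - T` for a Volterra operator `T`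
that has norm at most `1/2` in an exponentially weighted norm. Exceptional points of `P` are
removable because the Möbius values are bounded. -/

lemma primitive_eq_zero_of_nonpos {E : Type*} [NormedAddCommGroup E] [NormedSpace ℝ E] {f : ℝ → E}
    (hf : ∀ t < 0, f t = 0) {x : ℝ} (hx : x ≤ 0) : ∫ t in (0 : ℝ)..x, f t = 0 := by
  rw [intervalIntegral.integral_symm, intervalIntegral.integral_of_le hx,
    integral_Ioc_eq_integral_Ioo, setIntegral_eq_zero_of_forall_eq_zero, neg_zero]
  exact fun t ht => hf t ht.2

lemma intervalIntegrable_of_locally {E : Type*} [NormedAddCommGroup E] {f : ℝ → E}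
    (hf : LocallyIntegrable f) (x y : ℝ) : IntervalIntegrable f volume x y :=
  (hf.integrableOn_isCompact isCompact_uIcc).intervalIntegrable

lemma continuous_primitive_of_locallyIntegrable {E : Type*} [NormedAddCommGroup E]
    [NormedSpace ℝ E] {f : ℝ → E} (hf : LocallyIntegrable f) :
    Continuous fun x => ∫ t in (0 : ℝ)..x, f t :=
  intervalIntegral.continuous_primitive (fun x y => intervalIntegrable_of_locally hf x y) 0

lemma monotone_primitive (ha : LocallyIntegrable a) (h0 : ∀ t, 0 ≤ a t) :
    Monotone fun x => ∫ t in (0 : ℝ)..x, a t := by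
  intro x y hxy
  have := intervalIntegral.integral_interval_sub_left
    (intervalIntegrable_of_locally ha 0 y) (intervalIntegrable_of_locally ha 0 x)
  have h2 := intervalIntegral.integral_nonneg hxy (μ := volume) (fun t _ => h0 t)
  simp only
  linarith

lemma primitive_nonneg (h0 : ∀ t, 0 ≤ a t) (hneg : ∀ t < 0, a t = 0)
    (x : ℝ) : 0 ≤ ∫ t in (0 : ℝ)..x, a t := by
  rcases le_total 0 x with hx | hx
  · exact intervalIntegral.integral_nonneg hx (fun t _ => h0 t)
  · exact (primitive_eq_zero_of_nonpos hneg hx).ge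

/-- The weight `exp (2 ∫₀ˣ a)` absorbs one integration against `a`. -/
lemma integral_mul_exp_primitive_le (ha : LocallyIntegrable a) (h0 : ∀ t, 0 ≤ a t)
    {x : ℝ} (hx : 0 ≤ x) :
    ∫ t in (0 : ℝ)..x, a t * Real.exp (2 * ∫ s in (0 : ℝ)..t, a s) ≤
      Real.exp (2 * ∫ s in (0 : ℝ)..x, a s) / 2 := by
  set g : ℝ → ℝ := fun t => Real.exp (2 * ∫ s in (0 : ℝ)..t, a s) / 2 with hg
  have hmono : Monotone g := by
    intro s t hst
    have := monotone_primitive ha h0 hst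
    simp only [hg] at this ⊢
    gcongr
  -- The integral of the derivative of a monotone function is at most its increment, so no absolute
  -- continuity of `g` is needed.
  have h1 := (hmono.monotoneOn (uIcc 0 x)).intervalIntegral_deriv_mem_uIcc
  have h2 : ∫ t in (0 : ℝ)..x, deriv g t =
      ∫ t in (0 : ℝ)..x, a t * Real.exp (2 * ∫ s in (0 : ℝ)..t, a s) := by
    apply intervalIntegral.integral_congr_ae
    filter_upwards [LocallyIntegrable.ae_hasDerivAt_integral ha] with t ht _
    have := (((ht 0).const_mul 2).exp.div_const 2).deriv
    rw [hg, this]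
    ring
  rw [uIcc_of_le (sub_nonneg.2 (hmono hx)), h2] at h1
  have : 0 ≤ g 0 := by simp only [hg]; positivity
  exact h1.2.trans (sub_le_self _ this)

lemma locallyIntegrable_mul_continuous {E : Type*} [NormedRing E] {B f : ℝ → E}
    (hB : LocallyIntegrable B)
    (hf : Continuous f) : LocallyIntegrable fun t => B t * f t := by
  intro x
  obtain ⟨k, hk, hxk⟩ := exists_compact_mem_nhds x
  have := (hB.integrableOn_isCompact hk).mul_continuousOn hf.continuousOn hk
  exact ⟨k, hxk, this⟩

variable {E : Type*} [NormedRing E] [NormedAlgebra ℂ E]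

/-- The Volterra operator with kernel bounded by `a`, conjugated by the weight
`exp (2 ∫₀ˣ a)`, has norm at most `1 / 2`. -/
lemma exists_volterra (ha : LocallyIntegrable a) (h0 : ∀ t, 0 ≤ a t) (hneg : ∀ t < 0, a t = 0)
    {B : ℝ → E} (hB : LocallyIntegrable B) (hBa : ∀ t, ‖B t‖ ≤ a t) :
    ∃ K : (ℝ →ᵇ E) →L[ℂ] (ℝ →ᵇ E), ‖K‖ ≤ 1 / 2 ∧ ∀ f x, K f x =
      Real.exp (-(2 * ∫ s in (0 : ℝ)..x, a s)) •
        ∫ t in (0 : ℝ)..x, B t * (Real.exp (2 * ∫ s in (0 : ℝ)..t, a s) • f t) := by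
  set α : ℝ → ℝ := fun x => ∫ s in (0 : ℝ)..x, a s with hα
  have hαc : Continuous α := continuous_primitive_of_locallyIntegrable ha
  have hint : ∀ f : ℝ →ᵇ E, LocallyIntegrable fun t => B t * (Real.exp (2 * α t) • f t) :=
    fun f => locallyIntegrable_mul_continuous hB (by fun_prop)
  have hBneg : ∀ t < 0, B t = 0 := fun t ht =>
    norm_le_zero_iff.1 ((hBa t).trans (hneg t ht).le)
  have hbound : ∀ (f : ℝ →ᵇ E) (x : ℝ), ‖Real.exp (-(2 * α x)) •
      ∫ t in (0 : ℝ)..x, B t * (Real.exp (2 * α t) • f t)‖ ≤ 1 / 2 * ‖f‖ := by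
    intro f x
    rcases le_total x 0 with hx | hx
    · rw [primitive_eq_zero_of_nonpos (fun t ht => by rw [hBneg t ht, zero_mul]) hx]
      simp only [smul_zero, norm_zero]
      positivity
    · have hai : LocallyIntegrable fun t => a t * (Real.exp (2 * α t) * ‖f‖) :=
        locallyIntegrable_mul_continuous (E := ℝ) ha (by fun_prop)
      have h1 : ‖∫ t in (0 : ℝ)..x, B t * (Real.exp (2 * α t) • f t)‖ ≤
          ∫ t in (0 : ℝ)..x, a t * (Real.exp (2 * α t) * ‖f‖) := by
        refine intervalIntegral.norm_integral_le_of_norm_le hx (ae_of_all _ fun t _ => ?_)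
          (intervalIntegrable_of_locally hai 0 x)
        refine (norm_mul_le _ _).trans ?_
        rw [norm_smul, Real.norm_of_nonneg (Real.exp_pos _).le]
        gcongr
        · exact h0 t
        · exact hBa t
        · exact f.norm_coe_le_norm t
      have h2 : ∫ t in (0 : ℝ)..x, a t * (Real.exp (2 * α t) * ‖f‖) ≤
          Real.exp (2 * α x) / 2 * ‖f‖ := by
        simp only [← mul_assoc]
        rw [intervalIntegral.integral_mul_const]
        exact mul_le_mul_of_nonneg_right (integral_mul_exp_primitive_le ha h0 hx) (norm_nonneg _)
      rw [norm_smul, Real.norm_of_nonneg (Real.exp_pos _).le]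
      calc Real.exp (-(2 * α x)) * ‖∫ t in (0 : ℝ)..x, B t * (Real.exp (2 * α t) • f t)‖
          ≤ Real.exp (-(2 * α x)) * (Real.exp (2 * α x) / 2 * ‖f‖) := by
            gcongr; exact h1.trans h2
        _ = (Real.exp (-(2 * α x)) * Real.exp (2 * α x)) * (1 / 2 * ‖f‖) := by ring
        _ = 1 / 2 * ‖f‖ := by rw [← Real.exp_add]; simp
  let L : (ℝ →ᵇ E) →ₗ[ℂ] (ℝ →ᵇ E) :=
    { toFun := fun f => BoundedContinuousFunction.ofNormedAddCommGroup
        (fun x => Real.exp (-(2 * α x)) •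
          ∫ t in (0 : ℝ)..x, B t * (Real.exp (2 * α t) • f t))
        (by
          have := continuous_primitive_of_locallyIntegrable (hint f)
          fun_prop) (1 / 2 * ‖f‖) (hbound f)
      map_add' := by
        intro f g
        ext x
        simp only [BoundedContinuousFunction.coe_ofNormedAddCommGroup,
          BoundedContinuousFunction.coe_add, Pi.add_apply, smul_add, mul_add]
        rw [intervalIntegral.integral_add (intervalIntegrable_of_locally (hint f) _ _)
          (intervalIntegrable_of_locally (hint g) _ _), smul_add]
      map_smul' := by
        intro c f
        ext x
        have h1 : ∫ t in (0 : ℝ)..x, B t * (Real.exp (2 * α t) • (c • f) t) =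
            c • ∫ t in (0 : ℝ)..x, B t * (Real.exp (2 * α t) • f t) := by
          rw [← intervalIntegral.integral_smul]
          refine intervalIntegral.integral_congr fun t _ => ?_
          simp only [BoundedContinuousFunction.coe_smul]
          rw [smul_comm _ c, mul_smul_comm]
        exact (congrArg _ h1).trans (smul_comm _ c _) }
  refine ⟨L.mkContinuous (1 / 2) fun f => ?_, L.mkContinuous_norm_le (by norm_num) _, fun f x => ?_⟩
  · exact BoundedContinuousFunction.norm_ofNormedAddCommGroup_le _ (by positivity) (hbound f)
  · rfl

/-- A Lipschitz image of an absolutely continuous function is absolutely continuous. -/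
lemma _root_.AbsolutelyContinuousOnInterval.of_dist_le {X Y : Type*} [PseudoMetricSpace X]
    [PseudoMetricSpace Y] {f : ℝ → X} {g : ℝ → Y} {x y : ℝ}
    (hf : AbsolutelyContinuousOnInterval f x y) (K : ℝ)
    (h : ∀ s t, dist (g s) (g t) ≤ K * dist (f s) (f t)) :
    AbsolutelyContinuousOnInterval g x y := by
  refine squeeze_zero (fun t => Finset.sum_nonneg fun i _ => dist_nonneg) (fun t => ?_)
    (by simpa using Tendsto.const_mul K hf)
  rw [Finset.mul_sum]
  exact Finset.sum_le_sum fun i _ => h _ _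

/-- Increments of the primitive of `f` are dominated by those of the primitive of `‖f‖`, which
reduces the claim to the real case. -/
lemma absolutelyContinuousOnInterval_primitive {F : Type*} [NormedAddCommGroup F]
    [NormedSpace ℝ F] {f : ℝ → F} (hf : LocallyIntegrable f) (l : ℝ) :
    AbsolutelyContinuousOnInterval (fun x => ∫ t in (0 : ℝ)..x, f t) 0 l := by
  have hn : LocallyIntegrable fun t => ‖f t‖ := fun x => (hf x).norm
  refine (IntervalIntegrable.absolutelyContinuousOnInterval_intervalIntegral
    (intervalIntegrable_of_locally hn 0 l) left_mem_uIcc).of_dist_le 1 fun s t => ?_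
  rw [dist_eq_norm, dist_eq_norm, one_mul, intervalIntegral.integral_interval_sub_left
    (intervalIntegrable_of_locally hf _ _) (intervalIntegrable_of_locally hf _ _),
    intervalIntegral.integral_interval_sub_left
    (intervalIntegrable_of_locally hn _ _) (intervalIntegrable_of_locally hn _ _)]
  exact intervalIntegral.norm_integral_le_abs_integral_norm

lemma differentiableAt_inverse_one_sub {A : Type*} [NormedRing A] [NormedAlgebra ℂ A]
    [CompleteSpace A] {k₀ k₁ : A} {z : ℂ} (h : IsUnit (1 - (k₀ + z • k₁))) :
    DifferentiableAt ℂ (fun ζ : ℂ => Ring.inverse (1 - (k₀ + ζ • k₁))) z := by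
  have h1 : DifferentiableAt ℂ (fun ζ : ℂ => 1 - (k₀ + ζ • k₁)) z :=
    (((differentiableAt_id (𝕜 := ℂ)).smul_const k₁).const_add k₀).const_sub 1
  exact (differentiableAt_inverse (𝕜 := ℂ) h).comp z h1

/-- The initial value problem `U' = (B₀ + z B₁) U`, `U(0) = 1`, with locally summable coefficients
has a locally absolutely continuous solution that depends holomorphically on `z`. -/
theorem exists_solution_holomorphic [CompleteSpace E] {B₀ B₁ : ℝ → E}
    (h₀ : LocallyIntegrable B₀) (h₁ : LocallyIntegrable B₁)
    (h₀' : ∀ t < 0, B₀ t = 0) (h₁' : ∀ t < 0, B₁ t = 0) (R : ℝ) :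
    ∃ U : ℂ → ℝ → E, ∀ z : ℂ, ‖z‖ < R → U z 0 = 1 ∧
      (∀ l, AbsolutelyContinuousOnInterval (U z) 0 l) ∧
      (∀ᵐ x, HasDerivAt (U z) ((B₀ x + z • B₁ x) * U z x) x) ∧
      ∀ x, DifferentiableAt ℂ (fun ζ => U ζ x) z := by
  rcases le_or_gt R 0 with hR | hR
  · exact ⟨fun _ _ => 0, fun z hz => absurd (norm_nonneg z) (by linarith)⟩
  -- One weight must dominate `B₀`, `B₁` and every `B₀ + z B₁` with `‖z‖ < R`; the factor `R + 1 ≥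
  -- 1` also covers `B₁` alone.
  set a : ℝ → ℝ := fun t => ‖B₀ t‖ + (R + 1) * ‖B₁ t‖ with ha_def
  have ha : LocallyIntegrable a := by
    have h1 : LocallyIntegrable fun t => ‖B₀ t‖ := fun x => (h₀ x).norm
    have h2 : LocallyIntegrable fun t => (R + 1) * ‖B₁ t‖ :=
      LocallyIntegrable.smul (fun x => (h₁ x).norm) (R + 1)
    exact h1.add h2
  have ha0 : ∀ t, 0 ≤ a t := fun t => by simp only [ha_def]; positivity
  have haneg : ∀ t < 0, a t = 0 := fun t ht => by simp [ha_def, h₀' t ht, h₁' t ht]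
  obtain ⟨K₀, -, hK₀⟩ := exists_volterra ha ha0 haneg h₀ fun t => by
    simp only [ha_def]; have := norm_nonneg (B₁ t); nlinarith
  obtain ⟨K₁, -, hK₁⟩ := exists_volterra ha ha0 haneg h₁ fun t => by
    simp only [ha_def]; have := norm_nonneg (B₁ t); have := norm_nonneg (B₀ t); nlinarith
  set α : ℝ → ℝ := fun x => ∫ s in (0 : ℝ)..x, a s with hα
  have hαc : Continuous α := continuous_primitive_of_locallyIntegrable ha
  have hα0 : ∀ x, 0 ≤ α x := primitive_nonneg ha0 haneg
  have hBz : ∀ z : ℂ, LocallyIntegrable fun t => B₀ t + z • B₁ t := fun z => h₀.add (h₁.smul z)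
  -- The affine family `K₀ + z K₁` is itself the Volterra operator of `B₀ + z B₁`, so its norm is at
  -- most `1/2`; adding the separate bounds would not give this.
  have hT : ∀ z : ℂ, ‖z‖ < R → ‖K₀ + z • K₁‖ ≤ 1 / 2 ∧ ∀ f x, (K₀ + z • K₁) f x =
      Real.exp (-(2 * α x)) •
        ∫ t in (0 : ℝ)..x, (B₀ t + z • B₁ t) * (Real.exp (2 * α t) • f t) := by
    intro z hz
    obtain ⟨K, hK, hKf⟩ := exists_volterra ha ha0 haneg (hBz z) fun t => by
      simp only [ha_def]
      refine (norm_add_le _ _).trans ?_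
      rw [norm_smul]
      have := norm_nonneg (B₁ t)
      nlinarith
    have hKeq : K₀ + z • K₁ = K := by
      ext f x
      have hi : ∀ B : ℝ → E, LocallyIntegrable B → IntervalIntegrable
          (fun t => B t * (Real.exp (2 * α t) • f t)) volume 0 x := fun B hB =>
        intervalIntegrable_of_locally
          (locallyIntegrable_mul_continuous hB (by fun_prop)) 0 x
      rw [hKf, _root_.add_apply, _root_.smul_apply, BoundedContinuousFunction.add_apply,
        BoundedContinuousFunction.smul_apply, hK₀, hK₁, smul_comm z, ← smul_add,
        ← intervalIntegral.integral_smul]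
      congr 1
      refine (intervalIntegral.integral_add (hi _ h₀) ((hi _ h₁).smul z)).symm.trans ?_
      refine intervalIntegral.integral_congr fun t _ => ?_
      simp only [add_mul, smul_mul_assoc, Pi.smul_apply, hα]
    rw [hKeq]
    exact ⟨hK, hKf⟩
  -- The initial value `1` after division by the weight; `V` below is the weighted solution.
  let w : ℝ →ᵇ E := BoundedContinuousFunction.ofNormedAddCommGroup
    (fun x => Real.exp (-(2 * α x)) • (1 : E)) (by fun_prop) ‖(1 : E)‖ (fun x => by
      rw [norm_smul, Real.norm_of_nonneg (Real.exp_pos _).le]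
      refine mul_le_of_le_one_left (norm_nonneg _) (Real.exp_le_one_iff.2 ?_)
      linarith [hα0 x])
  have hunit : ∀ z : ℂ, ‖z‖ < R → IsUnit (1 - (K₀ + z • K₁)) := fun z hz =>
    isUnit_one_sub_of_norm_lt_one (R := (ℝ →ᵇ E) →L[ℂ] (ℝ →ᵇ E)) (x := K₀ + z • K₁)
      ((hT z hz).1.trans_lt (by norm_num))
  let V : ℂ → (ℝ →ᵇ E) := fun z => Ring.inverse (1 - (K₀ + z • K₁)) w
  have hV : ∀ z : ℂ, ‖z‖ < R → V z = w + (K₀ + z • K₁) (V z) := by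
    intro z hz
    have := congrArg (fun S => S w) (Ring.mul_inverse_cancel _ (hunit z hz))
    simp only [_root_.mul_apply_eq_comp, _root_.sub_apply,
      _root_.one_apply_eq_self] at this
    exact sub_eq_iff_eq_add.1 this
  have hVd : ∀ z : ℂ, ‖z‖ < R → DifferentiableAt ℂ V z := by
    intro z hz
    have h2 := differentiableAt_inverse_one_sub (A := (ℝ →ᵇ E) →L[ℂ] (ℝ →ᵇ E)) (hunit z hz)
    exact DifferentiableAt.clm_apply h2 (differentiableAt_const w)
  let U : ℂ → ℝ → E := fun z x => Real.exp (2 * α x) • V z x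
  have hU : ∀ z : ℂ, ‖z‖ < R → ∀ x, U z x =
      1 + ∫ t in (0 : ℝ)..x, (B₀ t + z • B₁ t) * U z t := by
    intro z hz x
    have h1 : V z x = Real.exp (-(2 * α x)) • (1 : E) + Real.exp (-(2 * α x)) •
        ∫ t in (0 : ℝ)..x, (B₀ t + z • B₁ t) * (Real.exp (2 * α t) • V z t) := by
      conv_lhs => rw [hV z hz]
      rw [BoundedContinuousFunction.add_apply, (hT z hz).2]
      rfl
    simp only [U]
    conv_lhs => rw [h1]
    rw [← smul_add, smul_smul, ← Real.exp_add]
    simp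
  refine ⟨U, fun z hz => ?_⟩
  have hUc : Continuous (U z) := by simp only [U]; fun_prop
  have hint : LocallyIntegrable fun t => (B₀ t + z • B₁ t) * U z t :=
    locallyIntegrable_mul_continuous (hBz z) hUc
  have hUeq : U z = fun x => 1 + ∫ t in (0 : ℝ)..x, (B₀ t + z • B₁ t) * U z t :=
    funext (hU z hz)
  refine ⟨by rw [hU z hz]; simp, fun l => ?_, ?_, fun x => ?_⟩
  · rw [hUeq]
    refine (absolutelyContinuousOnInterval_primitive hint l).of_dist_le 1 fun s t => ?_
    simp
  · filter_upwards [LocallyIntegrable.ae_hasDerivAt_integral hint] with x hx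
    have := (hx 0).const_add (1 : E)
    rwa [← hUeq] at this
  · have h1 := ((BoundedContinuousFunction.evalCLM ℂ x : (ℝ →ᵇ E) →L[ℂ] E).differentiableAt.comp z
      (hVd z hz)).const_smul (Real.exp (2 * α x))
    exact h1

end Volterra

/-! ### Entrywise absolute continuity and differentiation of matrix products -/

section Entries

variable {p q r : Type*} [Fintype q] {x y : ℝ}

lemma absolutelyContinuousOnInterval_const (c : ℂ) :
    AbsolutelyContinuousOnInterval (fun _ => c) x y :=
  (LipschitzWith.const c).lipschitzOnWith.absolutelyContinuousOnInterval

lemma absolutelyContinuousOnInterval_matrix_mul {M : ℝ → Matrix p q ℂ} {N : ℝ → Matrix q r ℂ}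
    (hM : ∀ a b, AbsolutelyContinuousOnInterval (fun t => M t a b) x y)
    (hN : ∀ a b, AbsolutelyContinuousOnInterval (fun t => N t a b) x y) (a : p) (b : r) :
    AbsolutelyContinuousOnInterval (fun t => (M t * N t) a b) x y := by
  simp only [Matrix.mul_apply]
  have : ∀ s : Finset q,
      AbsolutelyContinuousOnInterval (fun t => ∑ c ∈ s, M t a c * N t c b) x y := by
    classical
    intro s
    induction s using Finset.induction_on with
    | empty => simpa using absolutelyContinuousOnInterval_const 0
    | insert c s hc ih =>
      simp only [Finset.sum_insert hc]
      exact ((hM a c).fun_smul (hN c b)).fun_add ih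
  exact this Finset.univ

lemma hasDerivAt_matrix_mul {M : ℝ → Matrix p q ℂ} {N : ℝ → Matrix q r ℂ} {M' : Matrix p q ℂ}
    {N' : Matrix q r ℂ} (hM : ∀ a b, HasDerivAt (fun t => M t a b) (M' a b) x)
    (hN : ∀ a b, HasDerivAt (fun t => N t a b) (N' a b) x) (a : p) (b : r) :
    HasDerivAt (fun t => (M t * N t) a b) ((M' * N x + M x * N') a b) x := by
  simp only [Matrix.mul_apply, Matrix.add_apply, ← Finset.sum_add_distrib]
  exact HasDerivAt.fun_sum fun c _ => (hM a c).mul (hN c b)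

end Entries

/-! ### Solutions of the Dirac system -/

section Dirac

variable {m₁ m₂ : ℕ} {v : ℝ → Matrix (Fin m₁) (Fin m₂) ℂ} {z z' : ℂ}

lemma sig_mul_sig : sig m₁ m₂ * sig m₁ m₂ = 1 := by
  simp [sig, fromBlocks_multiply, fromBlocks_one]

lemma conjTranspose_sig : (sig m₁ m₂)ᴴ = sig m₁ m₂ := by
  simp [sig, fromBlocks_conjTranspose]

lemma conjTranspose_bigV (w : Matrix (Fin m₁) (Fin m₂) ℂ) : (bigV w)ᴴ = bigV w := by
  simp [bigV, fromBlocks_conjTranspose]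

/-- Locally absolutely continuous solutions, with any number of columns, of the Dirac system. -/
structure IsDiracSolution {q : Type*} (v : ℝ → Matrix (Fin m₁) (Fin m₂) ℂ) (z : ℂ)
    (w : ℝ → Matrix (Fin m₁ ⊕ Fin m₂) q ℂ) : Prop where
  absolutelyContinuous :
    ∀ l : ℝ, 0 ≤ l → ∀ a b, AbsolutelyContinuousOnInterval (fun x => w x a b) 0 l
  equation : ∀ᵐ x ∂(volume.restrict (Ioi (0 : ℝ))), ∀ a b,
    HasDerivAt (fun t => w t a b)
      ((Complex.I • ((z • sig m₁ m₂ + sig m₁ m₂ * bigV (v x)) * w x)) a b) x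

lemma IsFundamentalSolution.isDiracSolution {u : ℝ → Matrix (Fin m₁ ⊕ Fin m₂) (Fin m₁ ⊕ Fin m₂) ℂ}
    (hu : IsFundamentalSolution v z u) : IsDiracSolution v z u :=
  ⟨hu.absolutelyContinuous, hu.equation⟩

lemma IsDiracSolution.mul_const {q r : Type*} [Fintype q]
    {w : ℝ → Matrix (Fin m₁ ⊕ Fin m₂) q ℂ} (hw : IsDiracSolution v z w) (C : Matrix q r ℂ) :
    IsDiracSolution v z fun x => w x * C := by
  refine ⟨fun l hl => absolutelyContinuousOnInterval_matrix_mul (hw.absolutelyContinuous l hl)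
    fun a b => absolutelyContinuousOnInterval_const _, ?_⟩
  filter_upwards [hw.equation] with x hx a b
  have := hasDerivAt_matrix_mul (N := fun _ => C) (N' := 0) hx
    (fun a b => hasDerivAt_const x (C a b)) a b
  simpa [Matrix.mul_assoc] using this

variable {q r : Type*} {w : ℝ → Matrix (Fin m₁ ⊕ Fin m₂) q ℂ}
  {y : ℝ → Matrix (Fin m₁ ⊕ Fin m₂) r ℂ}

lemma IsDiracSolution.absolutelyContinuous_form (hw : IsDiracSolution v z w)
    (hy : IsDiracSolution v z' y) {l : ℝ} (hl : 0 ≤ l) (a : r) (b : q) :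
    AbsolutelyContinuousOnInterval (fun x => ((y x)ᴴ * sig m₁ m₂ * w x) a b) 0 l := by
  have h1 : ∀ a b, AbsolutelyContinuousOnInterval (fun x => (y x)ᴴ a b) 0 l := fun a b =>
    (hy.absolutelyContinuous l hl b a).of_dist_le 1 fun s t => by
      rw [one_mul, Matrix.conjTranspose_apply, Matrix.conjTranspose_apply, dist_eq_norm,
        dist_eq_norm, ← star_sub, norm_star]
  have h2 := absolutelyContinuousOnInterval_matrix_mul (M := fun x => (y x)ᴴ)
    (N := fun _ => sig m₁ m₂) h1 fun a b => absolutelyContinuousOnInterval_const _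
  exact absolutelyContinuousOnInterval_matrix_mul (M := fun x => (y x)ᴴ * sig m₁ m₂) h2
    (hw.absolutelyContinuous l hl) a b

/-- The Lagrange identity. -/
lemma IsDiracSolution.hasDerivAt_form (hw : IsDiracSolution v z w)
    (hy : IsDiracSolution v z' y) : ∀ᵐ x ∂(volume.restrict (Ioi (0 : ℝ))), ∀ a b,
      HasDerivAt (fun t => ((y t)ᴴ * sig m₁ m₂ * w t) a b)
        (Complex.I * (z - star z') * ((y x)ᴴ * w x) a b) x := by
  filter_upwards [hw.equation, hy.equation] with x hwx hyx a b
  have h1 : ∀ a b, HasDerivAt (fun t => (y t)ᴴ a b)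
      ((Complex.I • ((z' • sig m₁ m₂ + sig m₁ m₂ * bigV (v x)) * y x))ᴴ a b) x := fun a b => by
    simpa [Matrix.conjTranspose_apply] using (hyx b a).star
  have h2 := hasDerivAt_matrix_mul (N := fun _ => sig m₁ m₂) (N' := 0) h1
    (fun a b => hasDerivAt_const x _)
  have h3 := hasDerivAt_matrix_mul h2 hwx a b
  convert h3 using 1
  have e1 : sig m₁ m₂ * (sig m₁ m₂ * bigV (v x)) = bigV (v x) := by
    rw [← Matrix.mul_assoc, sig_mul_sig, Matrix.one_mul]
  have e3 : (Complex.I • ((z' • sig m₁ m₂ + sig m₁ m₂ * bigV (v x)) * y x))ᴴ * sig m₁ m₂ =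
      (-Complex.I) • ((y x)ᴴ * (star z' • 1 + bigV (v x))) := by
    simp only [conjTranspose_smul, conjTranspose_mul, conjTranspose_add, conjTranspose_sig,
      conjTranspose_bigV, Matrix.smul_mul, Matrix.mul_assoc, Matrix.add_mul, sig_mul_sig,
      Matrix.mul_one, Complex.star_def, Complex.conj_I, Matrix.mul_add, Matrix.mul_smul]
  have e4 : (y x)ᴴ * sig m₁ m₂ *
      (Complex.I • ((z • sig m₁ m₂ + sig m₁ m₂ * bigV (v x)) * w x)) =
      Complex.I • ((y x)ᴴ * (z • 1 + bigV (v x)) * w x) := by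
    rw [Matrix.mul_smul, ← Matrix.mul_assoc, Matrix.mul_assoc _ (sig m₁ m₂), Matrix.mul_add,
      Matrix.mul_smul, sig_mul_sig, e1]
  -- Since `j² = 1`, the potential enters as `-i y* V w` and `+i y* V w`, which cancel.
  rw [Matrix.mul_zero, add_zero, e3, e4]
  simp only [Matrix.mul_add, Matrix.add_mul, Matrix.smul_mul, Matrix.mul_smul, Matrix.mul_one,
    Matrix.add_apply, Matrix.smul_apply, smul_eq_mul]
  ring

lemma ae_mem_uIcc_of_ae_restrict {P : ℝ → Prop} (h : ∀ᵐ x ∂(volume.restrict (Ioi (0 : ℝ))), P x)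
    {a b : ℝ} (ha : 0 ≤ a) (hb : 0 ≤ b) : ∀ᵐ x, x ∈ uIcc a b → P x := by
  rw [ae_restrict_iff' measurableSet_Ioi] at h
  filter_upwards [h, Measure.ae_ne volume (0 : ℝ)] with x hx h0 hxab
  exact hx (lt_of_le_of_ne ((le_min ha hb).trans hxab.1) h0.symm)

/-- The indefinite form `y* j w` of two solutions at conjugate spectral parameters is constant. -/
lemma IsDiracSolution.form_eq (hw : IsDiracSolution v z w)
    (hy : IsDiracSolution v (star z) y) {x : ℝ} (hx : 0 ≤ x) :
    (y x)ᴴ * sig m₁ m₂ * w x = (y 0)ᴴ * sig m₁ m₂ * w 0 := by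
  ext a b
  obtain ⟨C, hC⟩ := (hw.absolutelyContinuous_form hy hx a b).const_of_ae_hasDerivAt_zero
    (ae_mem_uIcc_of_ae_restrict (by
      filter_upwards [hw.hasDerivAt_form hy] with t ht
      simpa using ht a b) le_rfl hx)
  exact (hC x right_mem_uIcc).trans (hC 0 left_mem_uIcc).symm

/-- Decay of the indefinite form along a solution in the upper half-plane. -/
lemma IsDiracSolution.form_le (hw : IsDiracSolution v z w) (hz : 0 < z.im) (c : q) {x₁ x₂ K : ℝ}
    (h₁ : 0 ≤ x₁) (h₁₂ : x₁ ≤ x₂)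
    (hK : ∀ t ∈ Icc x₁ x₂, K ≤ (((w t)ᴴ * w t) c c).re) :
    (((w x₂)ᴴ * sig m₁ m₂ * w x₂) c c).re ≤
      (((w x₁)ᴴ * sig m₁ m₂ * w x₁) c c).re - 2 * z.im * K * (x₂ - x₁) := by
  set f : ℝ → ℝ := fun x => (((w x)ᴴ * sig m₁ m₂ * w x) c c).re with hf
  have hx₂ := h₁.trans h₁₂
  have hac : AbsolutelyContinuousOnInterval f x₁ x₂ := by
    refine ((hw.absolutelyContinuous_form hw hx₂ c c).mono ?_).of_dist_le 1 fun s t => ?_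
    · rw [uIcc_of_le h₁₂, uIcc_of_le hx₂]
      exact Icc_subset_Icc_left h₁
    · rw [one_mul, Real.dist_eq, dist_eq_norm, hf]
      rw [← Complex.sub_re]
      exact Complex.abs_re_le_norm _
  have hd : ∀ᵐ x, x ∈ uIcc x₁ x₂ → deriv f x ≤ -(2 * z.im * K) := by
    filter_upwards [ae_mem_uIcc_of_ae_restrict (hw.hasDerivAt_form hw) h₁ hx₂] with x hx hxm
    have h1 : HasDerivAt f (Complex.I * (z - star z) * ((w x)ᴴ * w x) c c).re x := 
      (Complex.reCLM.hasFDerivAt.comp_hasDerivAt x (hx hxm c c) :)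
    have h2 : Complex.I * (z - star z) = ((-(2 * z.im) : ℝ) : ℂ) := by
      rw [Complex.star_def, Complex.sub_conj]
      push_cast
      linear_combination (2 * z.im : ℂ) * Complex.I_mul_I
    rw [h1.deriv, h2, Complex.re_ofReal_mul]
    rw [uIcc_of_le h₁₂] at hxm
    nlinarith [hK x hxm]
  have h3 : ∫ x in x₁..x₂, deriv f x ≤ ∫ _ in x₁..x₂, -(2 * z.im * K) := by
    refine intervalIntegral.integral_mono_ae_restrict h₁₂ hac.intervalIntegrable_deriv
      intervalIntegrable_const ?_
    rw [EventuallyLE, ae_restrict_iff' measurableSet_Icc]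
    rwa [uIcc_of_le h₁₂] at hd
  rw [hac.integral_deriv_eq_sub, intervalIntegral.integral_const, smul_eq_mul] at h3
  simp only [hf] at h3 ⊢
  linarith

end Dirac

/-! ### The fundamental solution -/

section Fundamental

open scoped Matrix.Norms.L2Operator

lemma locallyIntegrable_indicator_Ici {f : ℝ → ℂ} (hf : LocallyIntegrableOn f (Ici 0)) :
    LocallyIntegrable ((Ici (0 : ℝ)).indicator f) := by
  rw [locallyIntegrable_iff]
  intro k hk
  have h1 : IntegrableOn f (Ici 0 ∩ k) :=
    hf.integrableOn_compact_subset inter_subset_left (hk.inter_left isClosed_Ici)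
  rw [IntegrableOn, integrable_indicator_iff measurableSet_Ici, IntegrableOn,
    Measure.restrict_restrict measurableSet_Ici]
  exact h1

lemma locallyIntegrable_matrix {n : Type*} [Fintype n] [DecidableEq n] {M : ℝ → Matrix n n ℂ}
    (hM : ∀ a b, LocallyIntegrable fun t => M t a b) : LocallyIntegrable M := by
  have h1 : M = fun t => ∑ a, ∑ b, M t a b • Matrix.single a b (1 : ℂ) := by
    ext1 t
    conv_lhs => rw [matrix_eq_sum_single (M t)]
    simp [Matrix.smul_single]
  rw [h1]
  intro x
  choose s hs hs' using fun a b => hM a b x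
  refine ⟨⋂ a, ⋂ b, s a b, by simpa [Filter.iInter_mem] using hs, ?_⟩
  refine integrable_finsetSum _ fun a _ => integrable_finsetSum _ fun b _ => ?_
  exact ((hs' a b).mono_set ((iInter_subset _ a).trans (iInter_subset _ b))).smul_const _

variable {m₁ m₂ : ℕ} {v : ℝ → Matrix (Fin m₁) (Fin m₂) ℂ} {z : ℂ}

lemma LocallySummable.entry (hv : LocallySummable v) (a b : Fin m₁ ⊕ Fin m₂) :
    LocallyIntegrableOn (fun t => (Complex.I • (sig m₁ m₂ * bigV (v t))) a b) (Ici 0) := by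
  have h : ∀ t, sig m₁ m₂ * bigV (v t) = fromBlocks 0 (v t) (-(v t)ᴴ) 0 := fun t => by
    simp [sig, bigV, fromBlocks_multiply]
  simp only [h]
  have hz : LocallyIntegrableOn (fun _ : ℝ => (0 : ℂ)) (Ici 0) :=
    locallyIntegrable_zero.locallyIntegrableOn _
  rcases a with i | k <;> rcases b with i' | k'
  · simpa using hz
  · intro x hx
    obtain ⟨s, hs, hi⟩ := hv i k' x hx
    have h2 : IntegrableOn (fun t => Complex.I * v t i k') s := Integrable.const_mul hi _
    exact ⟨s, hs, by simpa using h2⟩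
  · intro x hx
    obtain ⟨s, hs, hi⟩ := hv i' k x hx
    have h2 : IntegrableOn (fun t => star (v t i' k)) s :=
      (Complex.conjCLE.toContinuousLinearMap.integrable_comp hi)
    have h3 : IntegrableOn (fun t => -Complex.I * star (v t i' k)) s := Integrable.const_mul h2 _
    exact ⟨s, hs, by simpa using h3⟩
  · simpa using hz

/-- Existence of the fundamental solution and its holomorphic dependence on `z`. -/
lemma exists_isFundamentalSolution (hv : LocallySummable v) (R : ℝ) :
    ∃ U : ℂ → ℝ → Matrix (Fin m₁ ⊕ Fin m₂) (Fin m₁ ⊕ Fin m₂) ℂ, ∀ z : ℂ, ‖z‖ < R →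
      IsFundamentalSolution v z (U z) ∧
      ∀ x, DifferentiableAt ℂ (fun ζ => U ζ x) z := by
  -- Extension by zero to the negative axis, as the Volterra argument on the whole line requires.
  set B₀ : ℝ → Matrix (Fin m₁ ⊕ Fin m₂) (Fin m₁ ⊕ Fin m₂) ℂ :=
    (Ici 0).indicator fun t => Complex.I • (sig m₁ m₂ * bigV (v t)) with hB₀
  set B₁ : ℝ → Matrix (Fin m₁ ⊕ Fin m₂) (Fin m₁ ⊕ Fin m₂) ℂ :=
    (Ici 0).indicator fun _ => Complex.I • sig m₁ m₂ with hB₁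
  have hind : ∀ (f : ℝ → Matrix (Fin m₁ ⊕ Fin m₂) (Fin m₁ ⊕ Fin m₂) ℂ) a b,
      (fun t => (Ici (0 : ℝ)).indicator f t a b) = (Ici (0 : ℝ)).indicator fun t => f t a b := by
    intro f a b
    ext t
    by_cases ht : t ∈ Ici (0 : ℝ) <;> simp [ht]
  obtain ⟨U, hU⟩ := exists_solution_holomorphic (B₀ := B₀) (B₁ := B₁)
    (locallyIntegrable_matrix fun a b => by
      rw [hB₀, hind]; exact locallyIntegrable_indicator_Ici (hv.entry a b))
    (locallyIntegrable_matrix fun a b => by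
      rw [hB₁, hind]
      exact locallyIntegrable_indicator_Ici
        ((locallyIntegrable_const _).locallyIntegrableOn _))
    (fun t ht => indicator_of_notMem (by simpa using ht) _)
    (fun t ht => indicator_of_notMem (by simpa using ht) _) R
  refine ⟨U, fun z hz => ?_⟩
  obtain ⟨h0, hac, hd, hhol⟩ := hU z hz
  let e : ∀ a b, Matrix (Fin m₁ ⊕ Fin m₂) (Fin m₁ ⊕ Fin m₂) ℂ →L[ℂ] ℂ := fun a b =>
    LinearMap.toContinuousLinearMap (Matrix.entryLinearMap ℂ ℂ a b)
  have he : ∀ a b M, e a b M = M a b := fun _ _ _ => rfl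
  refine ⟨⟨fun l _ a b => ?_, h0, ?_⟩, hhol⟩
  · refine (hac l).of_dist_le ‖e a b‖ fun s t => ?_
    rw [dist_eq_norm, dist_eq_norm, ← he a b (U z s), ← he a b (U z t), ← map_sub]
    exact (e a b).le_opNorm _
  · filter_upwards [ae_restrict_of_ae hd, ae_restrict_mem measurableSet_Ioi] with x hx hx0 a b
    have hx0' : x ∈ Ici (0 : ℝ) := Ioi_subset_Ici_self hx0
    rw [hB₀, hB₁, indicator_of_mem hx0', indicator_of_mem hx0'] at hx
    have h1 : (Complex.I • (sig m₁ m₂ * bigV (v x)) + z • Complex.I • sig m₁ m₂) * U z x =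
        Complex.I • ((z • sig m₁ m₂ + sig m₁ m₂ * bigV (v x)) * U z x) := by
      rw [smul_comm z, ← smul_add, Matrix.smul_mul, add_comm]
    rw [h1] at hx
    exact ((e a b).restrictScalars ℝ).hasFDerivAt.comp_hasDerivAt x hx

lemma isFundamentalSolution_fundSol (hv : LocallySummable v) (z : ℂ) :
    IsFundamentalSolution v z fun x => fundSol v x z := by
  obtain ⟨U, hU⟩ := exists_isFundamentalSolution hv (‖z‖ + 1)
  exact Classical.epsilon_spec (p := fun u => IsFundamentalSolution v z u)
    ⟨U z, (hU z (by linarith)).1⟩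

/-- Constancy of `u(x, conj z)* j u(x, z)` gives an explicit left inverse of the solution, the
source of both invertibility and uniqueness. -/
lemma IsFundamentalSolution.form_eq {u w : ℝ → Matrix (Fin m₁ ⊕ Fin m₂) (Fin m₁ ⊕ Fin m₂) ℂ}
    (hw : IsFundamentalSolution v z w) (hu : IsFundamentalSolution v (star z) u) {x : ℝ}
    (hx : 0 ≤ x) : (sig m₁ m₂ * ((u x)ᴴ * sig m₁ m₂)) * w x = 1 := by
  have := hw.isDiracSolution.form_eq hu.isDiracSolution hx
  rw [hw.initial, hu.initial, conjTranspose_one, Matrix.one_mul, Matrix.mul_one] at this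
  rw [Matrix.mul_assoc, this, sig_mul_sig]

/-- Both solutions are the inverse of the same matrix `j u(x, conj z)* j`, so no Gronwall estimate
is needed. -/
lemma IsFundamentalSolution.eq_fundSol (hv : LocallySummable v)
    {w : ℝ → Matrix (Fin m₁ ⊕ Fin m₂) (Fin m₁ ⊕ Fin m₂) ℂ}
    (hw : IsFundamentalSolution v z w) {x : ℝ} (hx : 0 ≤ x) : w x = fundSol v x z := by
  have hu := isFundamentalSolution_fundSol hv (star z)
  have h1 := hw.form_eq hu hx
  have h2 := (isFundamentalSolution_fundSol hv z).form_eq hu hx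
  exact (inv_eq_right_inv h1).symm.trans (inv_eq_right_inv h2)

lemma isUnit_det_fundSol (hv : LocallySummable v) {x : ℝ} (hx : 0 ≤ x) :
    IsUnit (fundSol v x z).det :=
  isUnit_det_of_left_inverse ((isFundamentalSolution_fundSol hv z).form_eq
    (isFundamentalSolution_fundSol hv (star z)) hx)

/-- The holomorphic solutions exist only on discs `‖z‖ < R`; uniqueness identifies them with
`fundSol` near each point. -/
lemma differentiable_fundSol (hv : LocallySummable v) {x : ℝ} (hx : 0 ≤ x) :
    Differentiable ℂ fun ζ => fundSol v x ζ := by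
  intro z
  obtain ⟨U, hU⟩ := exists_isFundamentalSolution hv (‖z‖ + 1)
  refine ((hU z (by linarith)).2 x).congr_of_eventuallyEq ?_
  filter_upwards [(continuous_norm.tendsto z).eventually_lt_const (lt_add_one ‖z‖)] with ζ hζ
  exact ((hU ζ hζ).1.eq_fundSol hv hx).symm

lemma continuous_fundSol (hv : LocallySummable v) {x : ℝ} (hx : 0 ≤ x) :
    Continuous fun ζ => fundSol v x ζ :=
  (differentiable_fundSol hv hx).continuous

lemma differentiable_inv_fundSol (hv : LocallySummable v) {x : ℝ} (hx : 0 ≤ x) :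
    ∀ a b, Differentiable ℂ fun ζ => (fundSol v x ζ)⁻¹ a b := by
  intro a b z
  let e : Matrix (Fin m₁ ⊕ Fin m₂) (Fin m₁ ⊕ Fin m₂) ℂ →L[ℂ] ℂ :=
    LinearMap.toContinuousLinearMap (Matrix.entryLinearMap ℂ ℂ a b)
  simp only [nonsing_inv_eq_ringInverse]
  have h1 := (differentiableAt_inverse (𝕜 := ℂ) (x := fundSol v x z)
    ((isUnit_iff_isUnit_det _).2 (isUnit_det_fundSol hv hx))).comp z
      (differentiable_fundSol hv hx z)
  exact e.differentiableAt.comp z h1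

end Fundamental

/-! ### Matrix inequalities -/

section MatrixInequalities

variable {n p : Type*} [Fintype n]

lemma posSemidef_of_re_nonneg {M : Matrix n n ℂ} (hM : M.IsHermitian)
    (h : ∀ ξ, 0 ≤ (star ξ ⬝ᵥ M *ᵥ ξ).re) : M.PosSemidef := by
  refine .of_dotProduct_mulVec_nonneg hM fun ξ => ?_
  rw [Complex.nonneg_iff]
  exact ⟨h ξ, (hM.im_star_dotProduct_mulVec_self ξ).symm⟩

lemma exists_posDef_mul_self [DecidableEq n] {M : Matrix n n ℂ} (hM : M.PosDef) :
    ∃ P : Matrix n n ℂ, P.PosDef ∧ P * P = M := by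
  open scoped MatrixOrder Matrix.Norms.L2Operator in
  have h1 : CFC.sqrt M * CFC.sqrt M = M := CFC.sqrt_mul_sqrt_self M hM.posSemidef.nonneg
  refine ⟨CFC.sqrt M, ?_, h1⟩
  rw [(CFC.sqrt_nonneg M).posSemidef.posDef_iff_isUnit]
  have h2 := hM.isUnit
  rw [← h1] at h2
  exact isUnit_of_mul_isUnit_left h2

lemma replicateCol_form (S : Matrix n n ℂ) (ξ : n → ℂ) :
    ((replicateCol Unit ξ)ᴴ * S * replicateCol Unit ξ) () () = star ξ ⬝ᵥ S *ᵥ ξ := by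
  rw [dotProduct_mulVec]
  rfl

/-- Meant for `X = [I; W]`, `Y = [I; W']`: the difference has zero upper block, so the last term
involves only the lower diagonal block of `S`. -/
lemma parallelogram_form (S : Matrix n n ℂ) (X Y : Matrix n p ℂ) :
    ((1 / 2 : ℂ) • (X + Y))ᴴ * S * ((1 / 2 : ℂ) • (X + Y)) =
      (1 / 2 : ℂ) • (Xᴴ * S * X + Yᴴ * S * Y) - (1 / 4 : ℂ) • ((X - Y)ᴴ * S * (X - Y)) := by
  have h : star (1 / 2 : ℂ) = 1 / 2 := by simp
  simp only [conjTranspose_smul, h, conjTranspose_add, conjTranspose_sub, Matrix.smul_mul,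
    Matrix.mul_smul, Matrix.add_mul, Matrix.mul_add, Matrix.sub_mul, Matrix.mul_sub]
  module

end MatrixInequalities

/-! ### Matrix discs defined by a Hermitian form -/

section Disc

variable {m₁ m₂ : ℕ} {S : Matrix (Fin m₁ ⊕ Fin m₂) (Fin m₁ ⊕ Fin m₂) ℂ}

/-- The column `[I; W]`. -/
abbrev graphCol (W : Matrix (Fin m₂) (Fin m₁) ℂ) : Matrix (Fin m₁ ⊕ Fin m₂) (Fin m₁) ℂ :=
  fromRows 1 W

/-- The set of `W` with `[I W*] S [I; W] ≥ 0`. -/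
def matrixDisc (S : Matrix (Fin m₁ ⊕ Fin m₂) (Fin m₁ ⊕ Fin m₂) ℂ) :
    Set (Matrix (Fin m₂) (Fin m₁) ℂ) :=
  {W | ((graphCol W)ᴴ * S * graphCol W).PosSemidef}

lemma fromRows_form (A : Matrix (Fin m₁) (Fin m₁) ℂ) (B : Matrix (Fin m₁) (Fin m₂) ℂ)
    (C : Matrix (Fin m₂) (Fin m₁) ℂ) (D : Matrix (Fin m₂) (Fin m₂) ℂ)
    (X : Matrix (Fin m₁) (Fin m₁) ℂ)
    (W : Matrix (Fin m₂) (Fin m₁) ℂ) :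
    (fromRows X W : Matrix (Fin m₁ ⊕ Fin m₂) (Fin m₁) ℂ)ᴴ * fromBlocks A B C D * fromRows X W =
      Xᴴ * A * X + Xᴴ * B * W + Wᴴ * C * X + Wᴴ * D * W := by
  rw [conjTranspose_fromRows_eq_fromCols_conjTranspose, fromCols_mul_fromBlocks,
    fromCols_mul_fromRows]
  simp only [Matrix.add_mul]
  abel

lemma fromRows_sig_form (X : Matrix (Fin m₁) (Fin m₁) ℂ) (W : Matrix (Fin m₂) (Fin m₁) ℂ) :
    (fromRows X W : Matrix (Fin m₁ ⊕ Fin m₂) (Fin m₁) ℂ)ᴴ * sig m₁ m₂ * fromRows X W =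
      Xᴴ * X - Wᴴ * W := by
  rw [sig, fromRows_form]
  simp [sub_eq_add_neg]

lemma matrixDisc_mono {S' : Matrix (Fin m₁ ⊕ Fin m₂) (Fin m₁ ⊕ Fin m₂) ℂ}
    (h : (S' - S).PosSemidef) : matrixDisc S ⊆ matrixDisc S' := by
  intro W hW
  have := (h.conjTranspose_mul_mul_same (graphCol W)).add hW
  rwa [Matrix.mul_sub, Matrix.sub_mul, sub_add_cancel] at this

lemma nonExpansive_of_mem_matrixDisc (h : (sig m₁ m₂ - S).PosSemidef)
    {W : Matrix (Fin m₂) (Fin m₁) ℂ} (hW : W ∈ matrixDisc S) : NonExpansive W := by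
  have := matrixDisc_mono h hW
  rwa [matrixDisc, mem_ofPred_eq, fromRows_sig_form, conjTranspose_one, Matrix.mul_one] at this

lemma NonExpansive.norm_entry_le {p q : ℕ} {W : Matrix (Fin p) (Fin q) ℂ} (hW : NonExpansive W)
    (i : Fin p) (k : Fin q) : ‖W i k‖ ≤ 1 := by
  have h1 := (Complex.nonneg_iff.1 (PosSemidef.diag_nonneg hW (i := k))).1
  have h2 : (Wᴴ * W) k k = ((∑ l, ‖W l k‖ ^ 2 : ℝ) : ℂ) := by
    rw [Matrix.mul_apply]
    push_cast
    refine Finset.sum_congr rfl fun l _ => ?_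
    rw [Matrix.conjTranspose_apply, Complex.star_def, Complex.conj_mul']
  rw [Matrix.sub_apply, Matrix.one_apply_eq, h2, Complex.sub_re, Complex.one_re,
    Complex.ofReal_re] at h1
  have h3 : ‖W i k‖ ^ 2 ≤ ∑ l, ‖W l k‖ ^ 2 :=
    Finset.single_le_sum (f := fun l => ‖W l k‖ ^ 2) (fun l _ => by positivity) (Finset.mem_univ i)
  exact (sq_le_one_iff₀ (norm_nonneg _)).1 (by linarith)

lemma isClosed_posSemidef {n : Type*} [Fintype n] : IsClosed {M : Matrix n n ℂ | M.PosSemidef} := by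
  have h : {M : Matrix n n ℂ | M.PosSemidef} =
      {M | Mᴴ = M} ∩ ⋂ ξ : n → ℂ, {M | 0 ≤ star ξ ⬝ᵥ M *ᵥ ξ} := by
    ext M
    simp [posSemidef_iff_dotProduct_mulVec, IsHermitian]
  rw [h]
  refine (isClosed_eq (by fun_prop) continuous_id).inter (isClosed_iInter fun ξ => ?_)
  exact isClosed_le continuous_const (by fun_prop)

lemma continuous_fromRows_one : Continuous
    fun W : Matrix (Fin m₂) (Fin m₁) ℂ => graphCol W := by
  refine continuous_matrix fun a b => ?_
  rcases a with i | i
  · exact continuous_const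
  · exact continuous_id.matrix_elem i b

lemma isClosed_matrixDisc : IsClosed (matrixDisc S) := by
  have := continuous_fromRows_one (m₁ := m₁) (m₂ := m₂)
  exact isClosed_posSemidef.preimage
    (f := fun W : Matrix (Fin m₂) (Fin m₁) ℂ => (graphCol W)ᴴ * S * graphCol W) (by fun_prop)

lemma isCompact_matrixDisc (h : (sig m₁ m₂ - S).PosSemidef) : IsCompact (matrixDisc S) := by
  have hc : IsCompact (Set.pi univ fun _ : Fin m₂ => Set.pi univ fun _ : Fin m₁ =>
      Metric.closedBall (0 : ℂ) 1) :=
    isCompact_univ_pi fun _ => isCompact_univ_pi fun _ => isCompact_closedBall _ _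
  refine hc.of_isClosed_subset isClosed_matrixDisc fun W hW i _ k _ => ?_
  rw [mem_closedBall_zero_iff]
  exact (nonExpansive_of_mem_matrixDisc h hW).norm_entry_le i k

/-- Injective `Q` with `Q* S Q ≥ 0` have an invertible upper block and define points of the disc. -/
lemma isUnit_toRows₁ (h : (sig m₁ m₂ - S).PosSemidef) {Q : Matrix (Fin m₁ ⊕ Fin m₂) (Fin m₁) ℂ}
    (hQ : Function.Injective Q.mulVec) (hS : (Qᴴ * S * Q).PosSemidef) : IsUnit Q.toRows₁.det := by
  have h1 : (Qᴴ * sig m₁ m₂ * Q).PosSemidef := by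
    have := (h.conjTranspose_mul_mul_same Q).add hS
    rwa [Matrix.mul_sub, Matrix.sub_mul, sub_add_cancel] at this
  have hform : Qᴴ * sig m₁ m₂ * Q = Q.toRows₁ᴴ * Q.toRows₁ - Q.toRows₂ᴴ * Q.toRows₂ := by
    conv_lhs => rw [← Q.fromRows_toRows]
    exact fromRows_sig_form _ _
  rw [hform] at h1
  -- If `Q₁ ξ = 0`, then `Q₁* Q₁ - Q₂* Q₂ ≥ 0` forces `Q₂ ξ = 0`, hence `Q ξ = 0`.
  have H : ∀ ξ, Q.toRows₁ *ᵥ ξ = 0 → ξ = 0 := by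
    intro ξ hξ
    have h2 := h1.dotProduct_mulVec_nonneg ξ
    have h3 : star ξ ⬝ᵥ (Q.toRows₂ᴴ * Q.toRows₂) *ᵥ ξ =
        star (Q.toRows₂ *ᵥ ξ) ⬝ᵥ (Q.toRows₂ *ᵥ ξ) := by
      rw [← Matrix.mulVec_mulVec, dotProduct_mulVec, star_mulVec]
    rw [Matrix.sub_mulVec, ← Matrix.mulVec_mulVec, hξ, Matrix.mulVec_zero, zero_sub,
      dotProduct_neg, h3] at h2
    have h4 : Q.toRows₂ *ᵥ ξ = 0 := dotProduct_star_self_eq_zero.1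
      (le_antisymm (neg_nonneg.1 h2) (dotProduct_star_self_nonneg _))
    have h5 : Q *ᵥ ξ = 0 := by
      rw [← Q.fromRows_toRows, fromRows_mulVec, hξ, h4, Sum.elim_zero_zero]
    exact hQ (h5.trans (Matrix.mulVec_zero Q).symm)
  rw [← isUnit_iff_isUnit_det, ← mulVec_injective_iff_isUnit]
  exact (injective_iff_map_eq_zero (Matrix.mulVecLin Q.toRows₁)).2 H

lemma fromRows_one_div {Q : Matrix (Fin m₁ ⊕ Fin m₂) (Fin m₁) ℂ} (h : IsUnit Q.toRows₁.det) :
    graphCol (Q.toRows₂ * Q.toRows₁⁻¹) = Q * Q.toRows₁⁻¹ := by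
  conv_rhs => rw [← Q.fromRows_toRows]
  rw [fromRows_mul, fromRows_toRows, mul_nonsing_inv _ h]

lemma form_div {Q : Matrix (Fin m₁ ⊕ Fin m₂) (Fin m₁) ℂ} (h : IsUnit Q.toRows₁.det) :
    (graphCol (Q.toRows₂ * Q.toRows₁⁻¹))ᴴ * S * graphCol (Q.toRows₂ * Q.toRows₁⁻¹) =
      (Q.toRows₁⁻¹)ᴴ * (Qᴴ * S * Q) * Q.toRows₁⁻¹ := by
  rw [fromRows_one_div h, conjTranspose_mul]
  simp only [Matrix.mul_assoc]

lemma div_mem_matrixDisc {Q : Matrix (Fin m₁ ⊕ Fin m₂) (Fin m₁) ℂ} (h : IsUnit Q.toRows₁.det)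
    (hS : (Qᴴ * S * Q).PosSemidef) : Q.toRows₂ * Q.toRows₁⁻¹ ∈ matrixDisc S := by
  rw [matrixDisc, mem_ofPred_eq, form_div h]
  exact hS.conjTranspose_mul_mul_same _

/-- A disc with strictly negative lower block and a strictly interior point is a matrix ball. -/
lemma isMatrixBall_matrixDisc (hS : S.IsHermitian) (hD : (-S.toBlocks₂₂).PosDef)
    {W₀ : Matrix (Fin m₂) (Fin m₁) ℂ}
    (hW₀ : ((graphCol W₀)ᴴ * S * graphCol W₀).PosDef) : IsMatrixBall (matrixDisc S) := by
  set A := S.toBlocks₁₁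
  set B := S.toBlocks₁₂
  set D := -S.toBlocks₂₂ with hDdef
  have hSB : S = fromBlocks A B Bᴴ (-D) := by
    have h21 : S.toBlocks₂₁ = Bᴴ := by
      ext i k
      exact (hS.apply (Sum.inr i) (Sum.inl k)).symm
    conv_lhs => rw [← S.fromBlocks_toBlocks]
    rw [h21, hDdef, neg_neg]
  have hDu : IsUnit D.det := (isUnit_iff_isUnit_det _).1 hD.isUnit
  have hDh : Dᴴ = D := hD.isHermitian
  have hDih : (D⁻¹)ᴴ = D⁻¹ := by rw [conjTranspose_nonsing_inv, hDh]
  set C := D⁻¹ * Bᴴ with hC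
  set R := A + B * D⁻¹ * Bᴴ with hR
  -- Completing the square in `W`: `C` is the centre and `R` the Schur complement.
  have hform : ∀ W, (graphCol W)ᴴ * S * graphCol W = R - (W - C)ᴴ * D * (W - C) := by
    intro W
    have e1 : Cᴴ * D = B := by
      rw [hC, conjTranspose_mul, hDih, conjTranspose_conjTranspose, Matrix.mul_assoc,
        nonsing_inv_mul _ hDu, Matrix.mul_one]
    have e2 : Wᴴ * D * C = Wᴴ * Bᴴ := by
      rw [hC, Matrix.mul_assoc, mul_nonsing_inv_cancel_left _ _ hDu]
    have e3 : B * C = B * D⁻¹ * Bᴴ := by rw [hC, Matrix.mul_assoc]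
    rw [hSB, fromRows_form, conjTranspose_sub, Matrix.sub_mul, e1, Matrix.mul_sub, Matrix.sub_mul,
      Matrix.sub_mul, e2, e3, hR]
    simp only [conjTranspose_one, Matrix.one_mul, Matrix.mul_one, Matrix.mul_neg, Matrix.neg_mul]
    abel
  -- `R` is the form at `W₀`, which is positive definite, plus a positive semidefinite square.
  have hRpd : R.PosDef := by
    have := hW₀.add_posSemidef (hD.posSemidef.conjTranspose_mul_mul_same (W₀ - C))
    rwa [hform, sub_add_cancel] at this
  -- The semi-radii will be `D^(-1/2)` on the left and `R^(1/2)` on the right.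
  obtain ⟨Ds, hDs, hDs2⟩ := exists_posDef_mul_self hD
  obtain ⟨Rs, hRs, hRs2⟩ := exists_posDef_mul_self hRpd
  have hDsu : IsUnit Ds.det := (isUnit_iff_isUnit_det _).1 hDs.isUnit
  have hRsu : IsUnit Rs.det := (isUnit_iff_isUnit_det _).1 hRs.isUnit
  have hkey : ∀ ω : Matrix (Fin m₂) (Fin m₁) ℂ,
      (graphCol (C + Ds⁻¹ * ω * Rs))ᴴ * S * graphCol (C + Ds⁻¹ * ω * Rs) =
      star Rs * (1 - ωᴴ * ω) * Rs := by
    intro ω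
    have e1 : Rsᴴ = Rs := hRs.isHermitian
    have e2 : (Ds⁻¹)ᴴ = Ds⁻¹ := hDs.inv.isHermitian
    rw [hform, add_sub_cancel_left, ← hRs2, ← hDs2, conjTranspose_mul, conjTranspose_mul, e1, e2,
      star_eq_conjTranspose, e1, Matrix.mul_sub, Matrix.sub_mul, Matrix.mul_one]
    congr 1
    simp only [Matrix.mul_assoc]
    rw [mul_nonsing_inv_cancel_left _ _ hDsu, nonsing_inv_mul_cancel_left _ _ hDsu]
  refine ⟨C, Ds⁻¹, Rs, hDs.inv, hRs, ?_⟩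
  ext W
  constructor
  · intro hW
    have hWω : W = C + Ds⁻¹ * (Ds * (W - C) * Rs⁻¹) * Rs := by
      simp only [Matrix.mul_assoc]
      rw [nonsing_inv_mul _ hRsu, Matrix.mul_one, nonsing_inv_mul_cancel_left _ _ hDsu,
        add_sub_cancel]
    refine ⟨_, ?_, hWω⟩
    rw [matrixDisc, mem_ofPred_eq, hWω, hkey, hRs.isUnit.posSemidef_star_left_conjugate_iff] at hW
    exact hW
  · rintro ⟨ω, hω, rfl⟩
    rw [matrixDisc, mem_ofPred_eq, hkey, hRs.isUnit.posSemidef_star_left_conjugate_iff]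
    exact hω

/-- The diameter of a disc inside the unit ball is controlled by the lower block of `S`. -/
lemma norm_sub_sq_le_of_mem_matrixDisc (h : (sig m₁ m₂ - S).PosSemidef) {k : ℝ} (hk : 0 < k)
    (hD : (-S.toBlocks₂₂ - (k : ℂ) • 1).PosSemidef) {W W' : Matrix (Fin m₂) (Fin m₁) ℂ}
    (hW : W ∈ matrixDisc S) (hW' : W' ∈ matrixDisc S) (i : Fin m₂) (l : Fin m₁) :
    ‖W i l - W' i l‖ ^ 2 ≤ 4 / k := by
  set Δ := W - W' with hΔ
  set M := (1 / 2 : ℂ) • (W + W') with hM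
  have hrow : graphCol M =
      (1 / 2 : ℂ) • (graphCol W + graphCol W') := by
    ext (a | a) b
    · simp only [fromRows_apply_inl, Matrix.smul_apply, Matrix.add_apply, smul_eq_mul]
      ring
    · simp [hM, mul_add]
  have hdiff : (graphCol W - graphCol W') =
      fromRows 0 Δ := by
    ext (a | a) b <;> simp [hΔ]
  have hlow : (fromRows (0 : Matrix (Fin m₁) (Fin m₁) ℂ) Δ)ᴴ * S *
      fromRows (0 : Matrix (Fin m₁) (Fin m₁) ℂ) Δ =
      Δᴴ * S.toBlocks₂₂ * Δ := by
    conv_lhs => rw [← S.fromBlocks_toBlocks]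
    rw [fromRows_form]
    simp
  clear_value Δ M
  -- The form at the midpoint is at most `I - M* M`. By the parallelogram identity it equals the
  -- mean of the forms at `W` and `W'` plus `Δ* (-S₂₂) Δ / 4`.
  have h1 := h.conjTranspose_mul_mul_same (graphCol M)
  rw [Matrix.mul_sub, Matrix.sub_mul, fromRows_sig_form, hrow, parallelogram_form, hdiff, hlow,
    conjTranspose_one, Matrix.mul_one] at h1
  have h2 := (h1.add ((PosSemidef.add hW hW').smul (by norm_num : (0 : ℝ) ≤ 1 / 2))).add
    (posSemidef_conjTranspose_mul_self M)
  -- Everything but `I - (k/4) Δ* Δ ≥ 0` cancels; a diagonal entry gives the bound `4 / k`.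
  have h3 := h2.add ((hD.conjTranspose_mul_mul_same Δ).smul
    (by norm_num : (0 : ℝ) ≤ 1 / 4))
  have h4 := (Complex.nonneg_iff.1 (PosSemidef.diag_nonneg h3 (i := l))).1
  have h5 : (Δᴴ * Δ) l l = ((∑ a, ‖W a l - W' a l‖ ^ 2 : ℝ) : ℂ) := by
    rw [Matrix.mul_apply]
    push_cast
    refine Finset.sum_congr rfl fun a _ => ?_
    rw [Matrix.conjTranspose_apply, Complex.star_def, Complex.conj_mul', hΔ, Matrix.sub_apply]
  have h6 : ‖W i l - W' i l‖ ^ 2 ≤ ∑ a, ‖W a l - W' a l‖ ^ 2 :=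
    Finset.single_le_sum (f := fun a => ‖W a l - W' a l‖ ^ 2) (fun a _ => by positivity)
      (Finset.mem_univ i)
  rw [Matrix.mul_sub, Matrix.sub_mul, Matrix.mul_smul, Matrix.mul_one, Matrix.smul_mul] at h4
  simp only [Matrix.add_apply, Matrix.sub_apply, Matrix.smul_apply, h5, Matrix.one_apply_eq,
    Complex.add_re, Complex.sub_re, smul_eq_mul, Complex.smul_re, Matrix.mul_neg, Matrix.neg_mul,
    Matrix.neg_apply, Complex.neg_re, ← Complex.ofReal_mul, Complex.ofReal_re, Complex.one_re,
    Complex.mul_re] at h4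
  norm_num at h4
  rw [le_div_iff₀ hk]
  nlinarith

end Disc

/-! ### The Weyl discs -/

section WeylDisc

variable {m₁ m₂ : ℕ} {v : ℝ → Matrix (Fin m₁) (Fin m₂) ℂ} {z : ℂ}

/-- The Hermitian form `u(x,z)* j u(x,z)`. -/
noncomputable def weylForm (v : ℝ → Matrix (Fin m₁) (Fin m₂) ℂ) (x : ℝ) (z : ℂ) :
    Matrix (Fin m₁ ⊕ Fin m₂) (Fin m₁ ⊕ Fin m₂) ℂ :=
  (fundSol v x z)ᴴ * sig m₁ m₂ * fundSol v x z

lemma isHermitian_weylForm (x : ℝ) : (weylForm v x z).IsHermitian := by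
  rw [IsHermitian, weylForm]
  simp [conjTranspose_mul, conjTranspose_sig, Matrix.mul_assoc]

lemma weylForm_zero (hv : LocallySummable v) : weylForm v 0 z = sig m₁ m₂ := by
  have := (isFundamentalSolution_fundSol hv z).initial
  simp [weylForm, this]

/-- `IsDiracSolution.form_le` for the single column `u ξ`. The choice `K = 0` gives monotonicity; a
positive `K` gives linear growth. -/
lemma weylForm_re_le (hv : LocallySummable v) (hz : 0 < z.im) (ξ : Fin m₁ ⊕ Fin m₂ → ℂ)
    {x₁ x₂ K : ℝ} (h₁ : 0 ≤ x₁) (h₁₂ : x₁ ≤ x₂)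
    (hK : ∀ t ∈ Icc x₁ x₂, K ≤ (star (fundSol v t z *ᵥ ξ) ⬝ᵥ (fundSol v t z *ᵥ ξ)).re) :
    (star ξ ⬝ᵥ weylForm v x₂ z *ᵥ ξ).re ≤
      (star ξ ⬝ᵥ weylForm v x₁ z *ᵥ ξ).re - 2 * z.im * K * (x₂ - x₁) := by
  have hw := (isFundamentalSolution_fundSol hv z).isDiracSolution.mul_const (replicateCol Unit ξ)
  have h1 : ∀ x, ((fundSol v x z * replicateCol Unit ξ)ᴴ * sig m₁ m₂ *
      (fundSol v x z * replicateCol Unit ξ)) () () = star ξ ⬝ᵥ weylForm v x z *ᵥ ξ := fun x => by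
    rw [← replicateCol_form, weylForm, conjTranspose_mul]
    simp only [Matrix.mul_assoc]
  have h2 : ∀ x, ((fundSol v x z * replicateCol Unit ξ)ᴴ *
      (fundSol v x z * replicateCol Unit ξ)) () () =
      star (fundSol v x z *ᵥ ξ) ⬝ᵥ (fundSol v x z *ᵥ ξ) := fun x => rfl
  have := hw.form_le hz () h₁ h₁₂ (K := K) fun t ht => by rw [h2]; exact hK t ht
  rwa [h1, h1] at this

lemma posSemidef_weylForm_sub (hv : LocallySummable v) (hz : 0 < z.im) {x₁ x₂ : ℝ} (h₁ : 0 ≤ x₁)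
    (h₁₂ : x₁ ≤ x₂) : (weylForm v x₁ z - weylForm v x₂ z).PosSemidef := by
  refine posSemidef_of_re_nonneg ((isHermitian_weylForm _).sub (isHermitian_weylForm _)) fun ξ => ?_
  have := weylForm_re_le hv hz ξ h₁ h₁₂ (K := 0) fun t _ =>
    (Complex.nonneg_iff.1 (dotProduct_star_self_nonneg _)).1
  rw [Matrix.sub_mulVec, dotProduct_sub, Complex.sub_re]
  linarith

lemma posSemidef_sig_sub_weylForm (hv : LocallySummable v) (hz : 0 < z.im) {x : ℝ} (hx : 0 ≤ x) :
    (sig m₁ m₂ - weylForm v x z).PosSemidef := by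
  have := posSemidef_weylForm_sub hv hz le_rfl hx
  rwa [weylForm_zero hv] at this

/-- Holds because `j + I = diag(2I, 0) ≥ 0`. It converts an upper bound for the form into a lower
bound for the length of a solution. -/
lemma sig_form_re (η : Fin m₁ ⊕ Fin m₂ → ℂ) :
    -(star η ⬝ᵥ η).re ≤ (star η ⬝ᵥ sig m₁ m₂ *ᵥ η).re := by
  have h : sig m₁ m₂ + 1 = fromBlocks ((2 : ℂ) • 1) 0 0 0 := by
    rw [sig, ← fromBlocks_one, fromBlocks_add]
    simp [two_smul]
  have h2 : star η ⬝ᵥ sig m₁ m₂ *ᵥ η + star η ⬝ᵥ η = star η ⬝ᵥ (sig m₁ m₂ + 1) *ᵥ η := by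
    rw [Matrix.add_mulVec, Matrix.one_mulVec, dotProduct_add]
  have h3 : (0 : ℂ) ≤ star η ⬝ᵥ (sig m₁ m₂ + 1) *ᵥ η := by
    rw [h, fromBlocks_mulVec]
    simp only [Matrix.smul_mulVec, Matrix.one_mulVec, Matrix.zero_mulVec, add_zero]
    rw [dotProduct, Fintype.sum_sum_type]
    simp only [Sum.elim_inl, Sum.elim_inr, Pi.smul_apply, Function.comp_apply, smul_eq_mul,
      Pi.zero_apply, mul_zero, Finset.sum_const_zero, add_zero, Pi.star_apply]
    refine Finset.sum_nonneg fun i _ => ?_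
    rw [mul_left_comm]
    exact mul_nonneg (by norm_num) (star_mul_self_nonneg _)
  rw [← h2] at h3
  have h4 := (Complex.nonneg_iff.1 h3).1
  rw [Complex.add_re] at h4
  linarith

/-- Linear growth of the lower diagonal block. -/
lemma posSemidef_neg_weylForm_toBlocks₂₂_sub (hv : LocallySummable v) (hz : 0 < z.im) {x : ℝ}
    (hx : 0 ≤ x) : (-(weylForm v x z).toBlocks₂₂ -
      ((1 + 2 * z.im * x : ℝ) : ℂ) • (1 : Matrix (Fin m₂) (Fin m₂) ℂ)).PosSemidef := by
  have hherm : (-(weylForm v x z).toBlocks₂₂ -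
      ((1 + 2 * z.im * x : ℝ) : ℂ) • (1 : Matrix (Fin m₂) (Fin m₂) ℂ)).IsHermitian := by
    refine IsHermitian.sub (IsHermitian.neg ?_) ?_
    · ext i k
      exact (isHermitian_weylForm (v := v) (z := z) x).apply (Sum.inr i) (Sum.inr k)
    · rw [IsHermitian, conjTranspose_smul, conjTranspose_one, Complex.star_def, Complex.conj_ofReal]
  refine posSemidef_of_re_nonneg hherm fun η => ?_
  set ξ : Fin m₁ ⊕ Fin m₂ → ℂ := Sum.elim 0 η with hξ
  have hblock : ∀ S : Matrix (Fin m₁ ⊕ Fin m₂) (Fin m₁ ⊕ Fin m₂) ℂ,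
      star ξ ⬝ᵥ S *ᵥ ξ = star η ⬝ᵥ S.toBlocks₂₂ *ᵥ η := by
    intro S
    conv_lhs => rw [← S.fromBlocks_toBlocks]
    rw [fromBlocks_mulVec, dotProduct, Fintype.sum_sum_type]
    have h0 : Sum.elim (0 : Fin m₁ → ℂ) η ∘ Sum.inl = 0 := rfl
    have h1 : Sum.elim (0 : Fin m₁ → ℂ) η ∘ Sum.inr = η := rfl
    simp [hξ, dotProduct, h0, h1]
  have hsig : (star ξ ⬝ᵥ weylForm v 0 z *ᵥ ξ).re = -(star η ⬝ᵥ η).re := by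
    rw [weylForm_zero hv, hblock, sig, toBlocks_fromBlocks₂₂]
    simp [Matrix.neg_mulVec]
  -- Bootstrap: the form at `u ξ` stays at most `-|η|²` by monotonicity and is at least `-|u ξ|²`,
  -- so `|u ξ|² ≥ |η|²`. This lower bound is then fed back into the decay estimate.
  have hK : ∀ t ∈ Icc 0 x, (star η ⬝ᵥ η).re ≤
      (star (fundSol v t z *ᵥ ξ) ⬝ᵥ (fundSol v t z *ᵥ ξ)).re := by
    intro t ht
    have h1 := weylForm_re_le hv hz ξ le_rfl ht.1 (K := 0) fun t _ =>
      (Complex.nonneg_iff.1 (dotProduct_star_self_nonneg _)).1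
    have h2 := sig_form_re (fundSol v t z *ᵥ ξ)
    have h3 : star (fundSol v t z *ᵥ ξ) ⬝ᵥ sig m₁ m₂ *ᵥ (fundSol v t z *ᵥ ξ) =
        star ξ ⬝ᵥ weylForm v t z *ᵥ ξ := by
      rw [weylForm, star_mulVec, ← Matrix.mulVec_mulVec, ← Matrix.mulVec_mulVec,
        dotProduct_mulVec (star ξ)]
    rw [h3] at h2
    rw [hsig] at h1
    linarith
  have h1 := weylForm_re_le hv hz ξ le_rfl hx hK
  rw [hsig, hblock] at h1
  rw [Matrix.sub_mulVec, Matrix.neg_mulVec, Matrix.smul_mulVec, Matrix.one_mulVec, dotProduct_sub,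
    dotProduct_neg, dotProduct_smul, Complex.sub_re, Complex.neg_re, smul_eq_mul,
    Complex.re_ofReal_mul]
  linarith

/-- The transformed parameter `u⁻¹ P`. -/
lemma form_inv_fundSol (hv : LocallySummable v) {x : ℝ} (hx : 0 ≤ x) {q : Type*}
    (P : Matrix (Fin m₁ ⊕ Fin m₂) q ℂ) :
    ((fundSol v x z)⁻¹ * P)ᴴ * weylForm v x z * ((fundSol v x z)⁻¹ * P) =
      Pᴴ * sig m₁ m₂ * P := by
  have h := isUnit_det_fundSol (z := z) hv hx
  have h1 : fundSol v x z * ((fundSol v x z)⁻¹ * P) = P := mul_nonsing_inv_cancel_left _ _ h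
  have h2 : ((fundSol v x z)⁻¹ * P)ᴴ * (fundSol v x z)ᴴ = Pᴴ := by
    rw [← conjTranspose_mul, h1]
  rw [weylForm, Matrix.mul_assoc, Matrix.mul_assoc _ (fundSol v x z), h1, ← Matrix.mul_assoc,
    ← Matrix.mul_assoc, h2]

/-- `P* P > 0` makes `u⁻¹ P` injective, and its `weylForm` value is `P* j P ≥ 0`; the general disc
lemma applies since `weylForm ≤ j`. -/
lemma NonsingularJ.isUnit_toRows₁ (hv : LocallySummable v) (hz : 0 < z.im) {x : ℝ} (hx : 0 ≤ x)
    {P : Matrix (Fin m₁ ⊕ Fin m₂) (Fin m₁) ℂ} (hP : NonsingularJ P) :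
    IsUnit ((fundSol v x z)⁻¹ * P).toRows₁.det := by
  refine DiracWeyl.isUnit_toRows₁ (posSemidef_sig_sub_weylForm hv hz hx) ?_
    (by rw [form_inv_fundSol hv hx]; exact hP.2)
  have h1 : Function.Injective (Pᴴ * P).mulVec := mulVec_injective_iff_isUnit.2 hP.1.isUnit
  intro ξ η h
  apply h1
  have h2 := congrArg (fun y => Pᴴ *ᵥ (fundSol v x z *ᵥ y)) h
  simpa only [Matrix.mulVec_mulVec, mul_nonsing_inv_cancel_left _ _ (isUnit_det_fundSol hv hx)]
    using h2

lemma NonsingularJ.div_mem (hv : LocallySummable v) (hz : 0 < z.im) {x : ℝ} (hx : 0 ≤ x)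
    {P : Matrix (Fin m₁ ⊕ Fin m₂) (Fin m₁) ℂ} (hP : NonsingularJ P) :
    ((fundSol v x z)⁻¹ * P).toRows₂ * ((fundSol v x z)⁻¹ * P).toRows₁⁻¹ ∈
      matrixDisc (weylForm v x z) :=
  div_mem_matrixDisc (hP.isUnit_toRows₁ hv hz hx)
    (by rw [form_inv_fundSol hv hx]; exact hP.2)

/-- The constant parameter `[I; 0]` supplies an interior point of every disc, its nonemptiness, and
the analytic approximants of the limit. -/
lemma nonsingularJ_graphCol_zero :
    NonsingularJ (graphCol (0 : Matrix (Fin m₂) (Fin m₁) ℂ)) := by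
  have h : (graphCol (0 : Matrix (Fin m₂) (Fin m₁) ℂ))ᴴ *
      graphCol (0 : Matrix (Fin m₂) (Fin m₁) ℂ) = 1 := by
    rw [conjTranspose_fromRows_eq_fromCols_conjTranspose, fromCols_mul_fromRows]
    simp
  refine ⟨by rw [h]; exact PosDef.one, ?_⟩
  rw [fromRows_sig_form]
  simpa using PosSemidef.one

lemma isMatrixBall_weylDisc (hv : LocallySummable v) (hz : 0 < z.im) {x : ℝ} (hx : 0 ≤ x) :
    IsMatrixBall (matrixDisc (weylForm v x z)) := by
  set Q : Matrix (Fin m₁ ⊕ Fin m₂) (Fin m₁) ℂ :=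
    (fundSol v x z)⁻¹ * graphCol (0 : Matrix (Fin m₂) (Fin m₁) ℂ) with hQ
  have h : IsUnit Q.toRows₁.det := nonsingularJ_graphCol_zero.isUnit_toRows₁ hv hz hx
  refine isMatrixBall_matrixDisc (isHermitian_weylForm x) ?_ (W₀ := Q.toRows₂ * Q.toRows₁⁻¹) ?_
  · have h1 := posSemidef_neg_weylForm_toBlocks₂₂_sub hv hz hx
    have h2 : ((((1 + 2 * z.im * x : ℝ) : ℂ)) • (1 : Matrix (Fin m₂) (Fin m₂) ℂ)).PosDef :=
      PosDef.one.smul (by rw [Complex.zero_lt_real]; positivity)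
    have := h2.add_posSemidef h1
    rwa [add_sub_cancel] at this
  -- Here `P* j P = I`, so the form at `W₀` is `(Q₁⁻¹)* Q₁⁻¹ > 0`.
  · rw [form_div h, hQ, form_inv_fundSol hv hx, fromRows_sig_form]
    simp only [conjTranspose_one, conjTranspose_zero, Matrix.mul_one, Matrix.mul_zero, sub_zero]
    exact PosDef.conjTranspose_mul_self _ (mulVec_injective_iff_isUnit.2
      ((isUnit_iff_isUnit_det _).2 (isUnit_nonsing_inv_det _ h)))

end WeylDisc

/-! ### Analyticity of the linear fractional transformations -/

section Analytic

open scoped Matrix.Norms.L2Operator in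
lemma differentiableAt_inv_entry {n : Type*} [Fintype n] [DecidableEq n] {M : ℂ → Matrix n n ℂ}
    {z : ℂ} (hM : ∀ a b, DifferentiableAt ℂ (fun ζ => M ζ a b) z) (h : IsUnit (M z).det) (a b : n) :
    DifferentiableAt ℂ (fun ζ => (M ζ)⁻¹ a b) z := by
  have h1 : M = fun ζ => ∑ a, ∑ b, M ζ a b • Matrix.single a b (1 : ℂ) := by
    ext1 ζ
    conv_lhs => rw [matrix_eq_sum_single (M ζ)]
    simp [Matrix.smul_single]
  have h2 : DifferentiableAt ℂ M z := by
    rw [h1]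
    exact DifferentiableAt.fun_sum fun a _ => DifferentiableAt.fun_sum fun b _ =>
      (hM a b).smul_const _
  let e : Matrix n n ℂ →L[ℂ] ℂ := LinearMap.toContinuousLinearMap (Matrix.entryLinearMap ℂ ℂ a b)
  simp only [nonsing_inv_eq_ringInverse]
  exact e.differentiableAt.comp z ((differentiableAt_inverse (𝕜 := ℂ)
    ((isUnit_iff_isUnit_det _).2 h)).comp z h2)

/-- Removal of a discrete set of singularities of a bounded holomorphic function. -/
lemma exists_analytic_extension {f : ℂ → ℂ} {U : Set ℂ} (hU : IsOpen U)
    (hf : ∀ z ∈ U, ∀ᶠ ζ in 𝓝[≠] z, DifferentiableAt ℂ f ζ ∧ ‖f ζ‖ ≤ 1) :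
    ∃ g : ℂ → ℂ, AnalyticOnNhd ℂ g U ∧ ∀ z ∈ U, Tendsto f (𝓝[≠] z) (𝓝 (g z)) := by
  set g : ℂ → ℂ := fun z => limUnder (𝓝[≠] z) f with hg
  have key : ∀ z ∈ U, Tendsto f (𝓝[≠] z) (𝓝 (g z)) ∧ DifferentiableAt ℂ g z := by
    intro z hz
    obtain ⟨s, hs, hsf⟩ := mem_nhdsWithin_iff_exists_mem_nhds_inter.1 (hf z hz)
    have hd : DifferentiableOn ℂ f (s \ {z}) := fun ζ hζ => (hsf hζ).1.differentiableWithinAt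
    have hb : BddAbove (norm ∘ f '' (s \ {z})) := by
      refine ⟨1, ?_⟩
      rintro _ ⟨ζ, hζ, rfl⟩
      exact (hsf hζ).2
    have h1 := Complex.differentiableOn_update_limUnder_of_bddAbove hs hd hb
    have h2 := h1.differentiableAt hs
    refine ⟨?_, h2.congr_of_eventuallyEq ?_⟩
    · have h3 := h2.continuousAt.tendsto
      rw [Function.update_self] at h3
      refine (h3.mono_left nhdsWithin_le_nhds).congr' ?_
      filter_upwards [self_mem_nhdsWithin] with ζ hζ
      exact Function.update_of_ne hζ _ _
    -- Away from `z` the function `f` is continuous, so its punctured limit is its value; thus `g`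
    -- agrees near `z` with `f` repaired at `z` alone.
    · filter_upwards [hs] with ζ hζ
      by_cases h : ζ = z
      · subst h
        rw [Function.update_self]
      · rw [Function.update_of_ne h]
        exact ((hsf ⟨hζ, h⟩).1.continuousAt.tendsto.mono_left nhdsWithin_le_nhds).limUnder_eq
  exact ⟨g, DifferentiableOn.analyticOnNhd
    (fun z hz => (key z hz).2.differentiableWithinAt) hU, fun z hz => (key z hz).1⟩

lemma isOpen_upperPlane : IsOpen upperPlane := isOpen_lt continuous_const Complex.continuous_im

variable {m₁ m₂ : ℕ} {v : ℝ → Matrix (Fin m₁) (Fin m₂) ℂ} {z : ℂ}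
  {P : ℂ → Matrix (Fin m₁ ⊕ Fin m₂) (Fin m₁) ℂ}

lemma IsParameter.eventually (hP : IsParameter P) (hz : z ∈ upperPlane) :
    ∀ᶠ ζ in 𝓝[≠] z, ζ ∈ upperPlane ∧ NonsingularJ (P ζ) := by
  have h1 := mem_codiscreteWithin.1 hP.2 z hz
  rw [disjoint_principal_right] at h1
  filter_upwards [h1, nhdsWithin_le_nhds (isOpen_upperPlane.mem_nhds hz)] with ζ h2 h3
  refine ⟨h3, ?_⟩
  by_contra h4
  exact h2 ⟨h3, h4⟩

lemma differentiableAt_mobius (hv : LocallySummable v) {x : ℝ} (hx : 0 ≤ x)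
    (hP : ∀ a k, DifferentiableAt ℂ (fun ζ => P ζ a k) z)
    (h : IsUnit ((fundSol v x z)⁻¹ * P z).toRows₁.det) (i : Fin m₂) (k : Fin m₁) :
    DifferentiableAt ℂ (fun ζ => mobius v x P ζ i k) z := by
  have hQ : ∀ a b, DifferentiableAt ℂ (fun ζ => ((fundSol v x ζ)⁻¹ * P ζ) a b) z := fun a b => by
    simp only [Matrix.mul_apply]
    exact DifferentiableAt.fun_sum fun c _ =>
      (differentiable_inv_fundSol hv hx a c z).mul (hP c b)
  simp only [mobius, Matrix.mul_apply (M := toRows₂ _)]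
  exact DifferentiableAt.fun_sum fun c _ => (hQ (Sum.inr i) c).mul
    (differentiableAt_inv_entry (M := fun ζ => ((fundSol v x ζ)⁻¹ * P ζ).toRows₁)
      (fun a b => hQ (Sum.inl a) b) h c k)

/-- Off a discrete set the entries are holomorphic and, the values being non-expansive, bounded by
`1`; Riemann's theorem removes the singularities. -/
lemma exists_analytic_mobius (hv : LocallySummable v) {x : ℝ} (hx : 0 ≤ x) (hP : IsParameter P) :
    ∃ g : ℂ → Matrix (Fin m₂) (Fin m₁) ℂ, AnalyticInUpperPlane g ∧
      ∀ z ∈ upperPlane, Tendsto (mobius v x P) (𝓝[≠] z) (𝓝 (g z)) := by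
  have h : ∀ i k, ∃ g : ℂ → ℂ, AnalyticOnNhd ℂ g upperPlane ∧
      ∀ z ∈ upperPlane, Tendsto (fun ζ => mobius v x P ζ i k) (𝓝[≠] z) (𝓝 (g z)) := by
    intro i k
    refine exists_analytic_extension isOpen_upperPlane fun z hz => ?_
    have h1 : ∀ᶠ ζ in 𝓝[≠] z, ∀ a k, DifferentiableAt ℂ (fun ζ => P ζ a k) ζ := by
      simp only [eventually_all]
      exact fun a k => (hP.1 a k z hz).eventually_analyticAt.mono fun _ h => h.differentiableAt
    filter_upwards [h1, hP.eventually hz] with ζ h2 h3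
    exact ⟨differentiableAt_mobius hv hx h2 (h3.2.isUnit_toRows₁ hv h3.1 hx) i k,
      (nonExpansive_of_mem_matrixDisc (posSemidef_sig_sub_weylForm hv h3.1 hx)
        (h3.2.div_mem hv h3.1 hx)).norm_entry_le i k⟩
  choose g hga hgt using h
  exact ⟨fun z => Matrix.of fun i k => g i k z, hga,
    fun z hz => tendsto_pi_nhds.2 fun i => tendsto_pi_nhds.2 fun k => hgt i k z hz⟩

lemma continuous_inv_fundSol (hv : LocallySummable v) {x : ℝ} (hx : 0 ≤ x) :
    Continuous fun ζ => (fundSol v x ζ)⁻¹ :=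
  continuous_matrix fun a b => (differentiable_inv_fundSol hv hx a b).continuous

lemma continuousAt_matrix_mul {p q r : Type*} [Fintype q] {A : ℂ → Matrix p q ℂ}
    {B : ℂ → Matrix q r ℂ} (hA : ContinuousAt A z) (hB : ContinuousAt B z) :
    ContinuousAt (fun ζ => A ζ * B ζ) z := by
  have h : Continuous fun p : Matrix p q ℂ × Matrix q r ℂ => p.1 * p.2 :=
    continuous_fst.matrix_mul continuous_snd
  exact h.continuousAt.comp (f := fun ζ => (A ζ, B ζ)) (hA.prodMk hB)

lemma continuousAt_matrix_inv {n : Type*} [Fintype n] [DecidableEq n] {M : ℂ → Matrix n n ℂ}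
    (hM : ContinuousAt M z) (h : IsUnit (M z).det) : ContinuousAt (fun ζ => (M ζ)⁻¹) z := by
  have hdet : Continuous fun A : Matrix n n ℂ => A.det := continuous_id.matrix_det
  have hadj : Continuous fun A : Matrix n n ℂ => A.adjugate := continuous_id.matrix_adjugate
  have h0 : (M z).det ≠ 0 := h.ne_zero
  have h1 : ContinuousAt (fun ζ => (M ζ).det) z := hdet.continuousAt.comp hM
  have h2 : ContinuousAt (fun ζ => (M ζ).adjugate) z := hadj.continuousAt.comp hM
  have h3 : ContinuousAt (fun ζ => ((M ζ).det)⁻¹) z := ContinuousAt.inv₀ h1 h0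
  simp only [Matrix.inv_def, Ring.inverse_eq_inv']
  exact h3.smul h2

lemma continuousAt_mobius (hv : LocallySummable v) {x : ℝ} (hx : 0 ≤ x) (hP : ContinuousAt P z)
    (h : IsUnit ((fundSol v x z)⁻¹ * P z).toRows₁.det) : ContinuousAt (mobius v x P) z := by
  have hQ : ContinuousAt (fun ζ => (fundSol v x ζ)⁻¹ * P ζ) z :=
    continuousAt_matrix_mul (continuous_inv_fundSol hv hx).continuousAt hP
  have h1 : Continuous fun Q : Matrix (Fin m₁ ⊕ Fin m₂) (Fin m₁) ℂ => Q.toRows₁ :=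
    continuous_matrix fun a b => continuous_id.matrix_elem (Sum.inl a) b
  have h2 : Continuous fun Q : Matrix (Fin m₁ ⊕ Fin m₂) (Fin m₁) ℂ => Q.toRows₂ :=
    continuous_matrix fun a b => continuous_id.matrix_elem (Sum.inr a) b
  have h3 : ContinuousAt (fun ζ => (((fundSol v x ζ)⁻¹ * P ζ).toRows₁)⁻¹) z :=
    continuousAt_matrix_inv
      (h1.continuousAt.comp (f := fun ζ => (fundSol v x ζ)⁻¹ * P ζ) hQ) h
  exact continuousAt_matrix_mul
    (h2.continuousAt.comp (f := fun ζ => (fundSol v x ζ)⁻¹ * P ζ) hQ) h3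

/-! ### Identification of `N` with the Weyl discs, and the limit point -/

lemma continuous_weylForm (hv : LocallySummable v) {x : ℝ} (hx : 0 ≤ x) :
    Continuous fun ζ => weylForm v x ζ := by
  have h : Continuous fun ζ => fundSol v x ζ := continuous_fundSol hv hx
  exact (h.matrix_conjTranspose.matrix_mul continuous_const).matrix_mul h

/-- The disc moves with `ζ`, so closedness of the semidefinite cone is combined with joint
continuity of the form in `W` and `S`. -/
lemma mem_matrixDisc_of_tendsto (hv : LocallySummable v) {x : ℝ} (hx : 0 ≤ x) (hz : z ∈ upperPlane)
    (hP : IsParameter P) {W : Matrix (Fin m₂) (Fin m₁) ℂ}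
    (hW : Tendsto (mobius v x P) (𝓝[≠] z) (𝓝 W)) : W ∈ matrixDisc (weylForm v x z) := by
  have h1 : Continuous fun p : Matrix (Fin m₂) (Fin m₁) ℂ ×
      Matrix (Fin m₁ ⊕ Fin m₂) (Fin m₁ ⊕ Fin m₂) ℂ => (graphCol p.1)ᴴ * p.2 * graphCol p.1 := by
    have h2 := (continuous_fromRows_one (m₁ := m₁) (m₂ := m₂)).comp
      (continuous_fst (Y := Matrix (Fin m₁ ⊕ Fin m₂) (Fin m₁ ⊕ Fin m₂) ℂ))
    exact (h2.matrix_conjTranspose.matrix_mul continuous_snd).matrix_mul h2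
  have h3 := (h1.tendsto (W, weylForm v x z)).comp (hW.prodMk_nhds
    ((continuous_weylForm hv hx).continuousAt.tendsto.mono_left nhdsWithin_le_nhds))
  refine isClosed_posSemidef.mem_of_tendsto h3 ?_
  filter_upwards [hP.eventually hz] with ζ h4
  exact h4.2.div_mem hv h4.1 hx

lemma isParameter_const {Q : Matrix (Fin m₁ ⊕ Fin m₂) (Fin m₁) ℂ} (hQ : NonsingularJ Q) :
    IsParameter fun _ => Q :=
  ⟨fun _ _ _ _ => MeromorphicAt.const _ _, Eventually.of_forall fun _ => hQ⟩

lemma tendsto_mobius_const (hv : LocallySummable v) {x : ℝ} (hx : 0 ≤ x) (hz : 0 < z.im)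
    {Q : Matrix (Fin m₁ ⊕ Fin m₂) (Fin m₁) ℂ} (hQ : NonsingularJ Q) :
    Tendsto (mobius v x fun _ => Q) (𝓝[≠] z) (𝓝 (mobius v x (fun _ => Q) z)) :=
  (continuousAt_mobius hv hx continuousAt_const
    (hQ.isUnit_toRows₁ hv hz hx)).tendsto.mono_left nhdsWithin_le_nhds

/-- Every point `W` of the disc is already attained by a constant parameter, namely `u(x, z) [I; W]`
with `z` fixed. -/
lemma N_eq_matrixDisc (hv : LocallySummable v) {x : ℝ} (hx : 0 ≤ x) (hz : z ∈ upperPlane) :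
    N v x z = matrixDisc (weylForm v x z) := by
  refine Subset.antisymm (fun W ⟨P, hP, hW⟩ => mem_matrixDisc_of_tendsto hv hx hz hP hW)
    fun W hW => ?_
  set Q := fundSol v x z * graphCol W with hQ
  have hu := isUnit_det_fundSol (z := z) hv hx
  have hQinv : (fundSol v x z)⁻¹ * Q = graphCol W := nonsing_inv_mul_cancel_left _ _ hu
  have hQj : NonsingularJ Q := by
    constructor
    · refine PosDef.conjTranspose_mul_self _ fun ξ η h => ?_
      have h1 := congrArg (fun y => (fundSol v x z)⁻¹ *ᵥ y) h
      simp only [Matrix.mulVec_mulVec, hQinv, fromRows_mulVec, Matrix.one_mulVec] at h1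
      funext a
      exact congrFun h1 (Sum.inl a)
    · rw [← form_inv_fundSol (z := z) hv hx, hQinv]
      exact hW
  refine ⟨fun _ => Q, isParameter_const hQj, ?_⟩
  have h2 : mobius v x (fun _ => Q) z = W := by
    simp [mobius, hQinv]
  conv => rw [← h2]
  exact tendsto_mobius_const hv hx hz hQj

lemma N_antitone (hv : LocallySummable v) (hz : z ∈ upperPlane) {x₂ x₁ : ℝ} (h₂ : 0 ≤ x₂)
    (h : x₂ ≤ x₁) : N v x₁ z ⊆ N v x₂ z := by
  rw [N_eq_matrixDisc hv h₂ hz, N_eq_matrixDisc hv (h₂.trans h) hz]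
  exact matrixDisc_mono (posSemidef_weylForm_sub hv hz h₂ h)

lemma norm_sub_sq_le_of_mem_N (hv : LocallySummable v) (hz : z ∈ upperPlane) {x : ℝ} (hx : 0 ≤ x)
    {W W' : Matrix (Fin m₂) (Fin m₁) ℂ} (hW : W ∈ N v x z) (hW' : W' ∈ N v x z) (i : Fin m₂)
    (k : Fin m₁) : ‖W i k - W' i k‖ ^ 2 ≤ 4 / (1 + 2 * z.im * x) := by
  have hz' : 0 < z.im := hz
  rw [N_eq_matrixDisc hv hx hz] at hW hW'
  exact norm_sub_sq_le_of_mem_matrixDisc (posSemidef_sig_sub_weylForm hv hz hx) (by positivity)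
    (posSemidef_neg_weylForm_toBlocks₂₂_sub hv hz hx) hW hW' i k

lemma tendsto_diameter_bound {c : ℝ} (hc : 0 < c) :
    Tendsto (fun n : ℕ => 4 / (1 + 2 * c * n)) atTop (𝓝 0) := by
  refine Tendsto.div_atTop tendsto_const_nhds (tendsto_atTop_add_const_left _ _ ?_)
  exact tendsto_natCast_atTop_atTop.const_mul_atTop (by positivity)

/-- The Weyl discs shrink to a point. -/
lemma exists_iInter_N_eq_singleton (hv : LocallySummable v) (hz : z ∈ upperPlane) :
    ∃ W, (⋂ x ∈ Ici (0 : ℝ), N v x z) = {W} := by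
  have hz' : 0 < z.im := hz
  -- By nestedness integer `x` suffice, so Cantor's intersection theorem for sequences applies.
  have hne : (⋂ n : ℕ, N v n z).Nonempty := by
    refine IsCompact.nonempty_iInter_of_sequence_nonempty_isCompact_isClosed _
      (fun n => N_antitone hv hz n.cast_nonneg (by push_cast; linarith)) (fun n => ?_) ?_
      fun n => ?_
    · exact ⟨_, _, isParameter_const nonsingularJ_graphCol_zero,
        tendsto_mobius_const hv n.cast_nonneg hz nonsingularJ_graphCol_zero⟩
    · rw [N_eq_matrixDisc hv (Nat.cast_nonneg 0) hz]
      exact isCompact_matrixDisc (posSemidef_sig_sub_weylForm hv hz (Nat.cast_nonneg 0))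
    · rw [N_eq_matrixDisc hv n.cast_nonneg hz]
      exact isClosed_matrixDisc
  obtain ⟨W, hW⟩ := hne
  rw [mem_iInter] at hW
  refine ⟨W, Subset.antisymm (fun W' hW' => ?_) ?_⟩
  · ext i k
    have h1 : ∀ n : ℕ, ‖W' i k - W i k‖ ^ 2 ≤ 4 / (1 + 2 * z.im * n) := fun n =>
      norm_sub_sq_le_of_mem_N hv hz n.cast_nonneg
        (mem_iInter₂.1 hW' n (Nat.cast_nonneg n : (0 : ℝ) ≤ n)) (hW n) i k
    have h2 := ge_of_tendsto' (tendsto_diameter_bound hz') h1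
    rw [← sub_eq_zero, ← norm_eq_zero]
    exact pow_eq_zero_iff two_ne_zero |>.1 (le_antisymm h2 (sq_nonneg _))
  · rw [singleton_subset_iff, mem_iInter₂]
    intro x hx
    obtain ⟨n, hn⟩ := exists_nat_ge x
    exact N_antitone hv hz hx hn (hW n)

/-- Both `φ(z)` and the analytic value for the parameter `[I; 0]` lie in the disc at `x = n`, so the
diameter bound gives locally uniform convergence. -/
lemma analyticInUpperPlane_of_mem_N (hv : LocallySummable v)
    {φ : ℂ → Matrix (Fin m₂) (Fin m₁) ℂ}
    (hφ : ∀ z ∈ upperPlane, ∀ n : ℕ, φ z ∈ N v n z) : AnalyticInUpperPlane φ := by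
  intro i k
  have hP := isParameter_const (nonsingularJ_graphCol_zero (m₁ := m₁) (m₂ := m₂))
  choose g hga hgt using fun n : ℕ => exists_analytic_mobius hv n.cast_nonneg hP
  have hlim : TendstoLocallyUniformlyOn (fun (n : ℕ) ζ => g n ζ i k) (fun ζ => φ ζ i k) atTop
      upperPlane := by
    rw [Metric.tendstoLocallyUniformlyOn_iff]
    intro ε hε z hz
    have hz' : 0 < z.im := hz
    -- On this half-plane the diameter bound is uniform in `ζ`.
    refine ⟨{ζ | z.im / 2 < ζ.im}, mem_nhdsWithin_of_mem_nhds
      ((isOpen_lt continuous_const Complex.continuous_im).mem_nhds (half_lt_self hz')), ?_⟩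
    filter_upwards [(tendsto_diameter_bound (half_pos hz')).eventually_lt_const
      (pow_pos hε 2)] with n hn ζ hζ
    have hζ' : z.im / 2 < ζ.im := hζ
    have hζU : ζ ∈ upperPlane := (half_pos hz').trans hζ'
    have h1 := norm_sub_sq_le_of_mem_N hv hζU n.cast_nonneg (hφ ζ hζU n) ⟨_, hP, hgt n ζ hζU⟩ i k
    have h2 : 4 / (1 + 2 * ζ.im * n) ≤ 4 / (1 + 2 * (z.im / 2) * n) := by
      gcongr
    rw [dist_eq_norm]
    exact lt_of_pow_lt_pow_left₀ 2 hε.le (by linarith)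
  exact (hlim.differentiableOn (Eventually.of_forall fun n => (hga n i k).differentiableOn)
    isOpen_upperPlane).analyticOnNhd isOpen_upperPlane

end Analytic

end DiracWeyl

theorem mainTheorem3 (m₁ m₂ : ℕ) (v : ℝ → Matrix (Fin m₁) (Fin m₂) ℂ)
    (hv : DiracWeyl.LocallySummable v) :
    -- the normalized fundamental solution exists and is unique on `[0, ∞)`, and is invertible
    (∀ z : ℂ, DiracWeyl.IsFundamentalSolution v z (fun x => DiracWeyl.fundSol v x z) ∧
      (∀ w, DiracWeyl.IsFundamentalSolution v z w →
        ∀ x : ℝ, 0 ≤ x → w x = DiracWeyl.fundSol v x z) ∧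
      ∀ x : ℝ, 0 ≤ x → IsUnit (DiracWeyl.fundSol v x z).det) ∧
    -- the Möbius transformations are well defined: the matrix to be inverted is nonsingular
    -- wherever `P` satisfies its two inequalities, and `φ(x, ·, P)` extends to an analytic function
    (∀ x : ℝ, 0 ≤ x → ∀ P : ℂ → Matrix (Fin m₁ ⊕ Fin m₂) (Fin m₁) ℂ, DiracWeyl.IsParameter P →
      (∀ z ∈ DiracWeyl.upperPlane, DiracWeyl.NonsingularJ (P z) →
        IsUnit (((DiracWeyl.fundSol v x z)⁻¹ * P z).toRows₁).det) ∧
      ∃ g : ℂ → Matrix (Fin m₂) (Fin m₁) ℂ, DiracWeyl.AnalyticInUpperPlane g ∧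
        ∀ z ∈ DiracWeyl.upperPlane,
          Tendsto (DiracWeyl.mobius v x P) (𝓝[≠] z) (𝓝 (g z)) ∧
          (ContinuousAt P z → DiracWeyl.NonsingularJ (P z) →
            g z = DiracWeyl.mobius v x P z)) ∧
    -- the sets `𝒩(x, z)` are matrix balls, and they are nested
    (∀ z ∈ DiracWeyl.upperPlane, ∀ x : ℝ, 0 ≤ x →
      DiracWeyl.IsMatrixBall (DiracWeyl.N v x z)) ∧
    (∀ z ∈ DiracWeyl.upperPlane, ∀ x₂ x₁ : ℝ, 0 ≤ x₂ → x₂ ≤ x₁ →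
      DiracWeyl.N v x₁ z ⊆ DiracWeyl.N v x₂ z) ∧
    -- their intersection is a single point `φ(z)`; `φ` is unique, analytic and non-expansive
    ∃ φ : ℂ → Matrix (Fin m₂) (Fin m₁) ℂ,
      (∀ z ∈ DiracWeyl.upperPlane, (⋂ x ∈ Ici (0 : ℝ), DiracWeyl.N v x z) = {φ z}) ∧
      (∀ ψ : ℂ → Matrix (Fin m₂) (Fin m₁) ℂ,
        (∀ z ∈ DiracWeyl.upperPlane, (⋂ x ∈ Ici (0 : ℝ), DiracWeyl.N v x z) = {ψ z}) →
        EqOn ψ φ DiracWeyl.upperPlane) ∧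
      DiracWeyl.AnalyticInUpperPlane φ ∧
      ∀ z ∈ DiracWeyl.upperPlane, DiracWeyl.NonExpansive (φ z) := by
  open DiracWeyl in
  refine ⟨fun z => ⟨isFundamentalSolution_fundSol hv z, fun w hw x hx => hw.eq_fundSol hv hx,
    fun x hx => isUnit_det_fundSol hv hx⟩, fun x hx P hP => ⟨fun z hz hPz =>
    hPz.isUnit_toRows₁ hv hz hx, ?_⟩, fun z hz x hx => ?_, fun z hz x₂ x₁ h₂ h =>
    N_antitone hv hz h₂ h, ?_⟩
  · obtain ⟨g, hga, hgt⟩ := exists_analytic_mobius hv hx hP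
    exact ⟨g, hga, fun z hz => ⟨hgt z hz, fun hc hPz => tendsto_nhds_unique (hgt z hz)
      ((continuousAt_mobius hv hx hc (hPz.isUnit_toRows₁ hv hz hx)).tendsto.mono_left
        nhdsWithin_le_nhds)⟩⟩
  · rw [N_eq_matrixDisc hv hx hz]
    exact isMatrixBall_weylDisc hv hz hx
  -- The membership hypothesis sits under the existential so that `choose` yields a function on all
  -- of `ℂ`; values outside the half-plane are irrelevant.
  · have hex : ∀ z, ∃ W, z ∈ upperPlane → (⋂ x ∈ Ici (0 : ℝ), N v x z) = {W} := fun z => by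
      by_cases hz : z ∈ upperPlane
      · obtain ⟨W, hW⟩ := exists_iInter_N_eq_singleton hv hz
        exact ⟨W, fun _ => hW⟩
      · exact ⟨0, fun h => absurd h hz⟩
    choose φ hφ using hex
    have hmem : ∀ z ∈ upperPlane, ∀ n : ℕ, φ z ∈ N v n z := fun z hz n => by
      have h1 : φ z ∈ ⋂ x ∈ Ici (0 : ℝ), N v x z := by
        rw [hφ z hz]
        exact mem_singleton _
      exact mem_iInter₂.1 h1 n (Nat.cast_nonneg n : (0 : ℝ) ≤ n)
    refine ⟨φ, hφ, fun ψ hψ z hz => ?_, analyticInUpperPlane_of_mem_N hv hmem, fun z hz => ?_⟩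
    · exact (singleton_injective ((hφ z hz).symm.trans (hψ z hz))).symm
    -- At `x = 0` the form is `j`, whose disc is the unit ball.
    · have h1 := hmem z hz 0
      rw [N_eq_matrixDisc hv (Nat.cast_nonneg 0) hz] at h1
      exact nonExpansive_of_mem_matrixDisc
        (posSemidef_sig_sub_weylForm hv hz (Nat.cast_nonneg 0)) h1
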